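/- Let $H$ be a separable real Hilbert space with inner product $\langle\cdot,\cdot\rangle$ and norm $\|\cdot\|$, and let $A$ be a strictly positive selfadjoint operator on $H$ whose domain ${\mathcal D}(A)$ is compactly embedded in $H$. For $r\ge 0$ put $H^r={\mathcal D}(A^{r/4})$ with norm $\|u\|_r=\|A^{r/4}u\|$, and let ${\mathcal H}=H^2\times H\times H$. Let $\beta\in\mathbb R$ and let $f,g\in H$ (independent of time). For $t\ge 0$ let $S(t):{\mathcal H}\to{\mathcal H}$ be the solution operators of $$ \begin{cases} \partial_{tt}u+Au-A^{1/2}\theta+\big(\beta+\|u\|_1^2\big)A^{1/2}u=f,\\ \partial_t\theta+A^{1/2}\theta+A^{1/2}\partial_t u=g, \end{cases} \qquad t>0, $$ that is, $S(t)(u_0,u_1,\theta_0)=(u(t),\partial_t u(t),\theta(t))$, where $(u,\partial_t u,\theta)\in{\mathcal C}([0,\infty),{\mathcal H})$ is the unique weak solution with $(u(0),\partial_t u(0),\theta(0))=(u_0,u_1,\theta_0)$. Let ${\mathfrak A}\subset{\mathcal H}$ be the global attractor of $S(t)$: the compact set with $S(t){\mathfrak A}={\mathfrak A}$ for all $t\ge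 0$ and $\lim_{t\to\infty}\sup_{z\in B}\operatorname{dist}_{\mathcal H}(S(t)z,{\mathfrak A})=0$ for every bounded $B\subset{\mathcal H}$. Then $S(t)$ has the backward uniqueness property on ${\mathfrak A}$: if $S(t)z_1=S(t)z_2$ for some $t>0$ and $z_1,z_2\in{\mathfrak A}$, then $z_1=z_2$. Consequently, $S(t)$ maps ${\mathfrak A}$ bijectively onto ${\mathfrak A}$ for every $t\ge 0$, and the family $S(t)_{|{\mathfrak A}}$, $t\ge 0$, extends to a strongly continuous group of operators on ${\mathfrak A}$: there are maps $S(t):{\mathfrak A}\to{\mathfrak A}$, $t\in\mathbb R$, extending the given ones, with $S(0)=\mathrm{id}$, $S(t+\tau)=S(t)S(\tau)$ for all $t,\tau\in\mathbb R$ (so that $S(-t)=[S(t)_{|{\mathfrak A}}]^{-1}$), and such that $(t,z)\mapsto S(t)z$ is continuous from $\mathbb R\times{\mathfrak A}$ to ${\mathfrak A}$ in the topology of ${\mathcal H}$. -/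

import Mathlib

noncomputable section

namespace ThermoBeam

open Set Filter Topology
open scoped ENNReal

variable {H : Type*} [NormedAddCommGroup H] [InnerProductSpace ℝ H]

/-! ### Powers of a positive selfadjoint operator with compact inverse, and their domains -/

/-- `A` is strictly positive: `⟨A u, u⟩ ≥ c ‖u‖²` on the domain of `A`, for some `c > 0`. -/
def StrictlyPositive (A : H →ₗ.[ℝ] H) : Prop :=
  ∃ c : ℝ, 0 < c ∧ ∀ u : A.domain, c * ‖(u : H)‖ ^ 2 ≤ inner ℝ (A u) (u : H)

/-- The embedding of the domain of `A` (with the graph norm) into `H` is compact: the unit ball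
of the domain is relatively compact in `H`. -/
def CompactlyEmbeddedDomain (A : H →ₗ.[ℝ] H) : Prop :=
  IsCompact (closure {x : H | ∃ u : A.domain, (u : H) = x ∧ ‖(u : H)‖ ≤ 1 ∧ ‖A u‖ ≤ 1})

/-- The graph of the power `A ^ s`: the pairs `(u, w)` such that, for every eigenvector `e` of `A`
with eigenvalue `μ`, the coefficient of `w` along `e` is `μ ^ s` times the coefficient of `u`.
If `A` is strictly positive and selfadjoint with compactly embedded domain, then `H` has an
orthonormal basis `eₙ` of eigenvectors, with eigenvalues `λₙ > 0`, and the pairs are those with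
`∑ λₙ ^ (2 s) ⟨u, eₙ⟩² < ∞` and `w = ∑ λₙ ^ s ⟨u, eₙ⟩ eₙ`. -/
def fracPowGraph (A : H →ₗ.[ℝ] H) (s : ℝ) : Submodule ℝ (H × H) where
  carrier := {p | ∀ (μ : ℝ) (e : A.domain), A e = μ • (e : H) →
    inner ℝ p.2 (e : H) = μ ^ s * inner ℝ p.1 (e : H)}
  add_mem' := by
    intro p q hp hq μ e he
    simp only [Prod.fst_add, Prod.snd_add, inner_add_left, hp μ e he, hq μ e he]
    ring
  zero_mem' := by
    intro μ e _
    simp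
  smul_mem' := by
    intro c p hp μ e he
    simp only [Prod.smul_fst, Prod.smul_snd, real_inner_smul_left, hp μ e he]
    ring

/-- The power `A ^ s`, an unbounded operator on `H`. -/
def fracPow (A : H →ₗ.[ℝ] H) (s : ℝ) : H →ₗ.[ℝ] H := (fracPowGraph A s).toLinearPMap

/-- The space `H ^ r`, `r ≥ 0`: the domain of `A ^ (r / 4)`. It is a separate type because it
carries the norm `‖A ^ (r / 4) u‖`, not the norm of `H`. -/
def Scale (A : H →ₗ.[ℝ] H) (r : ℝ) : Type _ := (fracPow A (r / 4)).domain

namespace Scale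

variable {A : H →ₗ.[ℝ] H} {r : ℝ}

instance : AddCommGroup (Scale A r) := inferInstanceAs (AddCommGroup (fracPow A (r / 4)).domain)

instance : Module ℝ (Scale A r) := inferInstanceAs (Module ℝ (fracPow A (r / 4)).domain)

/-- The inclusion of `H ^ r` into `H`. -/
def incl : Scale A r →ₗ[ℝ] H := (fracPow A (r / 4)).domain.subtype

/-- The operator `A ^ (r / 4)`, as a linear map from its domain `H ^ r` to `H`. -/
def op : Scale A r →ₗ[ℝ] H := (fracPow A (r / 4)).toFun

/-- The norm of `H ^ r` is `‖A ^ (r / 4) u‖`. (It is definite as soon as the eigenvectors of `A`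
span a dense subspace and the eigenvalues are positive.) -/
instance : SeminormedAddCommGroup (Scale A r) :=
  SeminormedAddCommGroup.induced (Scale A r) H (op : Scale A r →ₗ[ℝ] H)

end Scale

open Classical in
/-- The norm `‖u‖_r = ‖A ^ (r / 4) u‖` of an element `u` of `H` that lies in `H ^ r`
(and `0` otherwise). -/
def scaleNorm (A : H →ₗ.[ℝ] H) (r : ℝ) (u : H) : ℝ :=
  if h : u ∈ (fracPow A (r / 4)).domain then ‖fracPow A (r / 4) ⟨u, h⟩‖ else 0

/-! ### The evolution problem and its solution operators -/

/-- The phase space `H² × H × H`. The norm is that of Mathlib's product, which is equivalent to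
the Hilbertian one. -/
abbrev Phase (A : H →ₗ.[ℝ] H) : Type _ := Scale A 2 × H × H

/-- `z = (u, v, θ)` is a weak solution on `[0, ∞)` of
`u'' + A u - A^{1/2} θ + (β + ‖u‖₁²) A^{1/2} u = f`, `θ' + A^{1/2} θ + A^{1/2} u' = g`
with time-independent `f, g ∈ H`: it is continuous with values in the phase space, `v = u'`, and
the two equations hold when tested against every `φ ∈ H²`. (All terms being continuous in time,
the derivatives are classical.) -/
structure IsWeakSolution (A : H →ₗ.[ℝ] H) (β : ℝ) (f g : H) (z : ℝ → Phase A) : Prop where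
  continuousOn : ContinuousOn z (Ici 0)
  deriv_u : ∀ t : ℝ, 0 ≤ t →
    HasDerivWithinAt (fun s => Scale.incl (z s).1) (z t).2.1 (Ici 0) t
  eq_u : ∀ (φ : Scale A 2) (t : ℝ), 0 ≤ t →
    HasDerivWithinAt (fun s => inner ℝ (z s).2.1 (Scale.incl φ))
      (inner ℝ f (Scale.incl φ)
        - inner ℝ (Scale.op (z t).1) (Scale.op φ)
        + inner ℝ (z t).2.2 (Scale.op φ)
        - (β + scaleNorm A 1 (Scale.incl (z t).1) ^ 2)
            * inner ℝ (Scale.op (z t).1) (Scale.incl φ))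
      (Ici 0) t
  eq_θ : ∀ (φ : Scale A 2) (t : ℝ), 0 ≤ t →
    HasDerivWithinAt (fun s => inner ℝ (z s).2.2 (Scale.incl φ))
      (inner ℝ g (Scale.incl φ)
        - inner ℝ (z t).2.2 (Scale.op φ)
        - inner ℝ (z t).2.1 (Scale.op φ))
      (Ici 0) t

open Classical in
/-- The solution operators: `S(t) z₀`, `t ≥ 0`, is the value at time `t` of the weak solution with
initial datum `z₀` (a junk value is used if there were none). -/
def solOp (A : H →ₗ.[ℝ] H) (β : ℝ) (f g : H) (t : ℝ) (z₀ : Phase A) : Phase A :=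
  if h : ∃ z : ℝ → Phase A, IsWeakSolution A β f g z ∧ z 0 = z₀ then h.choose t else z₀

/-! ### Global attractors -/

/-- The Hausdorff semidistance `sup_{x ∈ B} inf_{y ∈ K} dist x y`. -/
def semidist {X : Type*} [PseudoEMetricSpace X] (B K : Set X) : ℝ≥0∞ :=
  ⨆ x ∈ B, Metric.infEDist x K

/-- `K` is the global attractor of `S(t)`, `t ≥ 0`: it is compact, fully invariant, and attracts
every bounded set. -/
structure IsGlobalAttractor {X : Type*} [PseudoMetricSpace X] (S : ℝ → X → X) (K : Set X) :
    Prop where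
  isCompact : IsCompact K
  invariant : ∀ t : ℝ, 0 ≤ t → S t '' K = K
  attracting : ∀ B : Set X, Bornology.IsBounded B →
    Tendsto (fun t : ℝ => semidist (S t '' B) K) atTop (𝓝 0)

end ThermoBeam

end

/-!
The unknown is written as `(x, v, θ)` with `x = A ^ (1/2) u` and `v = u'`, so that the phase space
becomes `H × H × H`. Since `A⁻¹` is compact and symmetric, there is a Hilbert basis of eigenvectors
of `A` (`exists_eigenbasis`), and a weak solution is the same thing as a continuous curve in
`H × H × H` whose coefficients solve, for each eigenvalue `μ` of `A ^ (1/2)`, the system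
`x' = μ v`, `v' = μ (θ - x) + n`, `θ' = -μ (θ + v) + m`, where `m = g` and
`n = f - (β + ‖u‖₁²) x`
(`SpectralData.isSol_of_isWeakSolution`, `SpectralData.isWeakSolution_of_isSol`). The coupling
between the modes is a bounded, locally Lipschitz perturbation, because it does not involve `μ`.

*Well-posedness.* The principal part is dissipative, which gives an energy inequality
(`ModeSol.energy_le`) and with it uniqueness and continuous dependence on the initial value and on
`f`, `g` (`IsSol.energy_sub_le`). A Galerkin approximation is an exact solution for projected data
(`exists_galerkin`), so continuous dependence also makes the Galerkin approximations a Cauchy family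
and yields existence (`exists_isSol_global`).

*Backward uniqueness.* The linear part of a mode is `μ M` with a fixed real `3 × 3` matrix `M`,
whose characteristic polynomial `r³ + r² + 2 r + 1` has three distinct complex roots. In
eigencoordinates the difference of two solutions thus satisfies scalar equations
`y' = μ r y + h`, for which there is a Carleman estimate with the weight `e ^ (s t²)`, uniform in
the coefficient `μ r` (`carleman_scalar`). The estimates are summed over all modes; as `s → ∞`
they force a difference that vanishes at time `T` to vanish on `(0, T]`, hence at time `0`
(`ModeSol.eq_zero_of_eq_zero_end`). No smoothing property of the equation is needed.

*The group.* On the compact attractor the operators `S t` are therefore continuous bijections, whose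
inverses are continuous, and the semigroup extends to a flow (`exists_flow_of_bijective`).
-/

noncomputable section

namespace ThermoBeam

open Set Filter Topology
open scoped ENNReal

/-! ### Coefficients and diagonal operators in a Hilbert basis -/

section Basis

variable {H : Type*} [NormedAddCommGroup H] [InnerProductSpace ℝ H] {ι : Type*}

theorem hasSum_coef_sq (e : HilbertBasis ι ℝ H) (x : H) :
    HasSum (fun k => inner ℝ (e k) x ^ 2) (‖x‖ ^ 2) := by
  have h := e.hasSum_inner_mul_inner x x
  rw [real_inner_self_eq_norm_sq] at h
  have hf : (fun k => inner ℝ (e k) x ^ 2) = fun k => inner ℝ x (e k) * inner ℝ (e k) x := by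
    funext k
    rw [real_inner_comm, sq]
  rw [hf]
  exact h

theorem ext_coef (e : HilbertBasis ι ℝ H) {x y : H}
    (h : ∀ k, inner ℝ (e k) x = inner ℝ (e k) y) : x = y := by
  apply e.repr.injective
  ext k
  simpa [e.repr_apply_apply] using h k

theorem sum_coef_sq_le (e : HilbertBasis ι ℝ H) (s : Finset ι) (x : H) :
    ∑ k ∈ s, inner ℝ (e k) x ^ 2 ≤ ‖x‖ ^ 2 :=
  sum_le_hasSum s (fun _ _ => sq_nonneg _) (hasSum_coef_sq e x)

/-- The Cauchy-Schwarz inequality for partial sums of the coefficients. -/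
theorem sum_coef_mul_le (e : HilbertBasis ι ℝ H) (s : Finset ι) (x y : H) :
    ∑ k ∈ s, inner ℝ (e k) x * inner ℝ (e k) y ≤ ‖x‖ * ‖y‖ := by
  have h1 := Finset.sum_mul_sq_le_sq_mul_sq s (fun k => inner ℝ (e k) x) (fun k => inner ℝ (e k) y)
  have h2 : (∑ k ∈ s, inner ℝ (e k) x * inner ℝ (e k) y) ^ 2 ≤ (‖x‖ * ‖y‖) ^ 2 := by
    rw [mul_pow]
    exact h1.trans (mul_le_mul (sum_coef_sq_le e s x) (sum_coef_sq_le e s y)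
      (Finset.sum_nonneg fun _ _ => sq_nonneg _) (sq_nonneg _))
  exact le_of_sq_le_sq h2 (by positivity)

/-- `D` is the diagonal operator with entries `b k` in the Hilbert basis `e`. -/
def IsDiag (e : HilbertBasis ι ℝ H) (b : ι → ℝ) (D : H →L[ℝ] H) : Prop :=
  ∀ k x, inner ℝ (e k) (D x) = b k * inner ℝ (e k) x

theorem exists_isDiag (e : HilbertBasis ι ℝ H) (b : ι → ℝ) (C : ℝ) (hb : ∀ k, |b k| ≤ C) :
    ∃ D : H →L[ℝ] H, IsDiag e b D := by
  have hle : ∀ (x : H) k, (b k * inner ℝ (e k) x) ^ 2 ≤ C ^ 2 * inner ℝ (e k) x ^ 2 := by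
    intro x k
    rw [mul_pow]
    exact mul_le_mul_of_nonneg_right (sq_le_sq' (neg_le_of_abs_le (hb k)) (le_of_abs_le (hb k)))
      (sq_nonneg _)
  have hmem : ∀ x : H, Memℓp (fun k => b k * inner ℝ (e k) x) 2 := by
    intro x
    refine memℓp_gen ?_
    simp only [ENNReal.toReal_ofNat, Real.rpow_two, Real.norm_eq_abs, sq_abs]
    exact Summable.of_nonneg_of_le (fun _ => sq_nonneg _) (hle x)
      ((hasSum_coef_sq e x).summable.mul_left _)
  let y : H → H := fun x => e.repr.symm ⟨_, hmem x⟩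
  have hy : ∀ k x, inner ℝ (e k) (y x) = b k * inner ℝ (e k) x := by
    intro k x
    rw [← e.repr_apply_apply]
    simp [y]
  let L : H →ₗ[ℝ] H :=
    { toFun := y
      map_add' := fun u v => ext_coef e fun k => by
        simp only [inner_add_right, hy]; ring
      map_smul' := fun c u => ext_coef e fun k => by
        simp only [real_inner_smul_right, hy, RingHom.id_apply]; ring }
  refine ⟨L.mkContinuous |C| fun x => ?_, fun k x => hy k x⟩
  have h : ‖y x‖ ^ 2 ≤ C ^ 2 * ‖x‖ ^ 2 := by
    refine hasSum_le (fun k => ?_) (hasSum_coef_sq e (y x)) ((hasSum_coef_sq e x).mul_left _)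
    rw [hy]
    exact hle x k
  refine abs_le_of_sq_le_sq' (b := |C| * ‖x‖) ?_ (by positivity) |>.2
  rw [mul_pow, sq_abs]
  exact h

namespace IsDiag

variable {e : HilbertBasis ι ℝ H} {b : ι → ℝ} {D : H →L[ℝ] H}

theorem norm_apply_le (hD : IsDiag e b D) {C : ℝ} (hC : 0 ≤ C) (hb : ∀ k, |b k| ≤ C) (x : H) :
    ‖D x‖ ≤ C * ‖x‖ := by
  refine le_of_sq_le_sq ?_ (by positivity)
  rw [mul_pow]
  refine hasSum_le (fun k => ?_) (hasSum_coef_sq e (D x)) ((hasSum_coef_sq e x).mul_left _)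
  rw [hD k x, mul_pow]
  exact mul_le_mul_of_nonneg_right (sq_le_sq' (neg_le_of_abs_le (hb k)) (le_of_abs_le (hb k)))
    (sq_nonneg _)

theorem inner_comm (hD : IsDiag e b D) (x y : H) : inner ℝ (D x) y = inner ℝ x (D y) := by
  have h1 := e.hasSum_inner_mul_inner (D x) y
  have h2 := e.hasSum_inner_mul_inner x (D y)
  have hf : (fun k => inner ℝ (D x) (e k) * inner ℝ (e k) y)
      = fun k => inner ℝ x (e k) * inner ℝ (e k) (D y) := by
    funext k
    rw [hD k y, real_inner_comm, hD k x, real_inner_comm (e k) x]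
    ring
  rw [hf] at h1
  exact h1.unique h2

theorem apply_basis (hD : IsDiag e b D) (k : ι) : D (e k) = b k • e k := by
  refine ext_coef e fun j => ?_
  rw [hD j, real_inner_smul_right]
  by_cases h : j = k
  · rw [h]
  · rw [e.orthonormal.2 h, mul_zero, mul_zero]

end IsDiag

/-- An orthonormal family in a separable space is countable: the balls of radius `1 / 2` around
its members are disjoint. -/
theorem countable_of_hilbertBasis [TopologicalSpace.SeparableSpace H] (e : HilbertBasis ι ℝ H) :
    Countable ι := by
  have hdist : ∀ j k, j ≠ k → 1 ≤ dist (e j) (e k) := by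
    intro j k hjk
    rw [dist_eq_norm]
    have h : ‖e j - e k‖ ^ 2 = 2 := by
      rw [@norm_sub_sq ℝ, e.orthonormal.1 j, e.orthonormal.1 k, e.orthonormal.2 hjk]
      norm_num
    nlinarith [norm_nonneg (e j - e k)]
  have : (univ : Set ι).Countable := by
    refine Set.PairwiseDisjoint.countable_of_isOpen (s := fun k => Metric.ball (e k) (1 / 2))
      ?_ (fun _ _ => Metric.isOpen_ball) (fun k _ => ⟨e k, by simp⟩)
    intro j _ k _ hjk
    exact Metric.ball_disjoint_ball (by linarith [hdist j k hjk])
  exact countable_univ_iff.1 this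

end Basis

/-! ### The eigenbasis of a positive selfadjoint operator with compact inverse -/

section Spectral

universe u

variable {H : Type u} [NormedAddCommGroup H] [InnerProductSpace ℝ H]
  {A : H →ₗ.[ℝ] H}

theorem StrictlyPositive.mul_norm_le {c : ℝ}
    (hc : ∀ u : A.domain, c * ‖(u : H)‖ ^ 2 ≤ inner ℝ (A u) (u : H)) (u : A.domain) :
    c * ‖(u : H)‖ ≤ ‖A u‖ := by
  rcases eq_or_ne (‖(u : H)‖) 0 with h | h
  · rw [h, mul_zero]; exact norm_nonneg _
  · have h0 : 0 < ‖(u : H)‖ := lt_of_le_of_ne (norm_nonneg _) (Ne.symm h)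
    have := (hc u).trans (real_inner_le_norm _ _)
    nlinarith

variable [CompleteSpace H]

theorem inner_apply_comm (hA : IsSelfAdjoint A) (u w : A.domain) :
    inner ℝ (A u) (w : H) = inner ℝ (u : H) (A w) := by
  have h := LinearPMap.adjoint_isFormalAdjoint (T := A) hA.dense_domain
  rw [LinearPMap.isSelfAdjoint_def.1 hA] at h
  exact h u w

/-- A strictly positive selfadjoint operator is onto: its range is closed, because the operator is
closed and bounded below, and the orthogonal complement of the range is the kernel. -/
theorem StrictlyPositive.surjective (hA : IsSelfAdjoint A) (hpos : StrictlyPositive A) (w : H) :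
    ∃ u : A.domain, A u = w := by
  obtain ⟨c, hc0, hc⟩ := hpos
  have hbelow := StrictlyPositive.mul_norm_le hc
  let R : Submodule ℝ H := LinearMap.range A.toFun
  have hRc : IsClosed (R : Set H) := by
    have : CompleteSpace A.graph := hA.isClosed.completeSpace_coe
    let π : A.graph → H := fun p => (p : H × H).2
    have hanti : AntilipschitzWith (max c⁻¹ 1).toNNReal π := by
      refine AntilipschitzWith.of_le_mul_dist fun p q => ?_
      obtain ⟨u, hu1, hu2⟩ := (LinearPMap.mem_graph_iff A).1 (p - q).2
      have h := hbelow u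
      rw [hu1, hu2] at h
      have h2 : dist (π p) (π q) = ‖((p - q : A.graph) : H × H).2‖ := by
        rw [dist_eq_norm]; rfl
      have h1 : dist p q = ‖((p - q : A.graph) : H × H)‖ := by
        rw [dist_eq_norm]; rfl
      rw [h1, h2, Prod.norm_def, Real.coe_toNNReal _ (by positivity)]
      refine max_le ?_ ?_
      · refine le_trans ?_ (mul_le_mul_of_nonneg_right (le_max_left _ _) (norm_nonneg _))
        rw [← div_eq_inv_mul, le_div_iff₀ hc0, mul_comm]
        exact h
      · exact le_mul_of_one_le_left (norm_nonneg _) (le_max_right _ _)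
    have huc : UniformContinuous π := uniformContinuous_snd.comp uniformContinuous_subtype_val
    have hrange : (R : Set H) = range π := by
      ext x
      constructor
      · rintro ⟨u, rfl⟩
        exact ⟨⟨_, LinearPMap.mem_graph A u⟩, rfl⟩
      · rintro ⟨p, rfl⟩
        obtain ⟨u, -, hu2⟩ := (LinearPMap.mem_graph_iff A).1 p.2
        exact ⟨u, hu2⟩
    rw [hrange]
    exact hanti.isClosed_range huc
  have hRo : Rᗮ = ⊥ := by
    rw [eq_bot_iff]
    intro y hy
    have hy' : ∀ u : A.domain, inner ℝ (0 : H) (u : H) = inner ℝ y (A u) := by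
      intro u
      rw [inner_zero_left, real_inner_comm]
      exact ((Submodule.mem_orthogonal _ _).1 hy _ ⟨u, rfl⟩).symm
    have hdom : y ∈ A.adjoint.domain := LinearPMap.mem_adjoint_domain_of_exists y ⟨0, hy'⟩
    have h0 : A.adjoint ⟨y, hdom⟩ = 0 :=
      LinearPMap.adjoint_apply_eq hA.dense_domain ⟨y, hdom⟩ hy'
    have hgr : (y, (0 : H)) ∈ A.adjoint.graph := (LinearPMap.mem_graph_iff _).2 ⟨⟨y, hdom⟩, rfl, h0⟩
    rw [LinearPMap.isSelfAdjoint_def.1 hA] at hgr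
    obtain ⟨u, hu1, hu2⟩ := (LinearPMap.mem_graph_iff A).1 hgr
    have := hbelow u
    simp only at hu1 hu2
    rw [hu1, hu2, norm_zero] at this
    have : ‖y‖ ≤ 0 := by nlinarith
    simpa using this
  have : CompleteSpace R := hRc.completeSpace_coe
  have hRt : R = ⊤ := Submodule.orthogonal_eq_bot_iff.1 hRo
  have : w ∈ R := hRt ▸ Submodule.mem_top
  exact this

/-- The inverse of a strictly positive selfadjoint operator with compactly embedded domain, a
compact symmetric operator. -/
theorem exists_compact_inverse (hA : IsSelfAdjoint A) (hpos : StrictlyPositive A)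
    (hcpt : CompactlyEmbeddedDomain A) :
    ∃ T : H →L[ℝ] H, IsCompactOperator T ∧ (T : H →ₗ[ℝ] H).IsSymmetric ∧
      ∀ w, ∃ u : A.domain, (u : H) = T w ∧ A u = w := by
  have hsurj := hpos.surjective hA
  obtain ⟨c, hc0, hc⟩ := hpos
  have hbelow := StrictlyPositive.mul_norm_le hc
  have hinj : Function.Injective A.toFun := by
    rw [← LinearMap.ker_eq_bot, LinearMap.ker_eq_bot']
    intro u hu
    have h := hbelow u
    change A u = 0 at hu
    rw [hu, norm_zero] at h
    have : ‖(u : H)‖ ≤ 0 := by nlinarith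
    simpa using this
  let E := LinearEquiv.ofBijective A.toFun ⟨hinj, hsurj⟩
  have hE : ∀ w, A (E.symm w) = w := fun w => E.apply_symm_apply w
  let T : H →L[ℝ] H := (A.domain.subtype ∘ₗ E.symm.toLinearMap).mkContinuous c⁻¹ (by
    intro w
    have h := hbelow (E.symm w)
    rw [hE] at h
    rw [← div_eq_inv_mul, le_div_iff₀ hc0, mul_comm]
    exact h)
  have hT : ∀ w, T w = (E.symm w : H) := fun w => rfl
  refine ⟨T, ?_, ?_, fun w => ⟨E.symm w, rfl, hE w⟩⟩
  · rw [isCompactOperator_iff_exists_mem_nhds_image_subset_compact]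
    refine ⟨Metric.closedBall 0 (min 1 c), Metric.closedBall_mem_nhds _ (by positivity), _,
      hcpt, ?_⟩
    rintro _ ⟨w, hw, rfl⟩
    rw [mem_closedBall_zero_iff] at hw
    refine subset_closure ⟨E.symm w, rfl, ?_, ?_⟩
    · have h := hbelow (E.symm w)
      rw [hE] at h
      have := hw.trans (min_le_right _ _)
      nlinarith
    · rw [hE]
      exact hw.trans (min_le_left _ _)
  · intro x y
    change inner ℝ (T x) y = inner ℝ x (T y)
    rw [hT, hT]
    conv_lhs => rw [← hE y]
    conv_rhs => rw [← hE x]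
    exact (inner_apply_comm hA _ _).symm

/-- The eigenspaces of a compact symmetric operator provide a Hilbert basis of eigenvectors. -/
theorem exists_eigenbasis_of_compact (T : H →L[ℝ] H) (hT : IsCompactOperator T)
    (hs : (T : H →ₗ[ℝ] H).IsSymmetric) :
    ∃ (ι : Type u) (e : HilbertBasis ι ℝ H) (ν : ι → ℝ), ∀ k, T (e k) = ν k • e k := by
  let G : ℝ → Submodule ℝ H := fun ν => Module.End.eigenspace (T : Module.End ℝ H) ν
  have hGmem : ∀ ν x, x ∈ G ν ↔ T x = ν • x := fun ν x => Module.End.mem_eigenspace_iff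
  have hGc : ∀ ν, CompleteSpace (G ν) := by
    intro ν
    have : IsClosed (G ν : Set H) := by
      have h : (G ν : Set H) = {x | T x = ν • x} := by ext x; exact hGmem ν x
      rw [h]
      exact isClosed_eq T.continuous (continuous_const_smul ν)
    exact this.completeSpace_coe
  have hex : ∀ ν, ∃ (w : Set (G ν)) (b : HilbertBasis w ℝ (G ν)), ⇑b = ((↑) : w → G ν) :=
    fun ν => exists_hilbertBasis ℝ (G ν)
  choose w b hb using hex
  have hfam : OrthogonalFamily ℝ (fun ν => G ν) fun ν => (G ν).subtypeₗᵢ :=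
    hs.orthogonalFamily_eigenspaces
  have hv : Orthonormal ℝ (fun a : Σ ν, w ν => ((b a.1 a.2 : G a.1) : H)) :=
    hfam.orthonormal_sigma_orthonormal (v_family := fun ν => b ν) fun ν => (b ν).orthonormal
  have hbot : (Submodule.span ℝ (range fun a : Σ ν, w ν => ((b a.1 a.2 : G a.1) : H)))ᗮ = ⊥ := by
    rw [eq_bot_iff]
    intro y hy
    have h1 : y ∈ (⨆ ν, G ν)ᗮ := by
      rw [Submodule.mem_orthogonal]
      intro x hx
      have hle : (⨆ ν, G ν) ≤ (ℝ ∙ y)ᗮ := by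
        refine iSup_le fun ν x hx => ?_
        rw [Submodule.mem_orthogonal_singleton_iff_inner_right]
        have hsum := ((b ν).hasSum_repr ⟨x, hx⟩).mapL ((innerSL ℝ y).comp (G ν).subtypeL)
        refine hsum.unique ?_
        convert hasSum_zero using 2 with k
        have := (Submodule.mem_orthogonal _ _).1 hy _ (Submodule.subset_span ⟨⟨ν, k⟩, rfl⟩)
        simp [real_inner_comm] at this ⊢
        right
        exact this
      have := hle hx
      rw [Submodule.mem_orthogonal_singleton_iff_inner_right, real_inner_comm] at this
      exact this
    have h2 : (⨆ ν, G ν)ᗮ = ⊥ :=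
      ContinuousLinearMap.orthogonalComplement_iSup_eigenspaces_eq_bot hT hs
    rwa [h2] at h1
  refine ⟨_, HilbertBasis.mkOfOrthogonalEqBot hv hbot, fun a => a.1, fun a => ?_⟩
  rw [HilbertBasis.coe_mkOfOrthogonalEqBot]
  exact (hGmem _ _).1 (b a.1 a.2).2

/-- An eigenbasis of `A`: the eigenvectors of the inverse, with the reciprocal eigenvalues. -/
theorem exists_eigenbasis (hA : IsSelfAdjoint A) (hpos : StrictlyPositive A)
    (hcpt : CompactlyEmbeddedDomain A) :
    ∃ (ι : Type u) (e : HilbertBasis ι ℝ H) (lam : ι → ℝ) (c : ℝ), 0 < c ∧ (∀ k, c ≤ lam k) ∧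
      ∀ k, ∃ u : A.domain, (u : H) = e k ∧ A u = lam k • e k := by
  obtain ⟨T, hTc, hTs, hT⟩ := exists_compact_inverse hA hpos hcpt
  obtain ⟨ι, e, ν, he⟩ := exists_eigenbasis_of_compact T hTc hTs
  obtain ⟨c, hc0, hc⟩ := hpos
  have hν : ∀ k, ν k ≠ 0 := by
    intro k h0
    obtain ⟨u, hu1, hu2⟩ := hT (e k)
    rw [he, h0, zero_smul] at hu1
    have : u = 0 := by ext; exact hu1
    rw [this, LinearPMap.map_zero] at hu2
    have h1 := e.orthonormal.1 k
    rw [← hu2, norm_zero] at h1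
    exact zero_ne_one h1
  have heig : ∀ k, ∃ u : A.domain, (u : H) = e k ∧ A u = (ν k)⁻¹ • e k := by
    intro k
    obtain ⟨u, hu1, hu2⟩ := hT (e k)
    refine ⟨(ν k)⁻¹ • u, ?_, ?_⟩
    · rw [Submodule.coe_smul, hu1, he, inv_smul_smul₀ (hν k)]
    · rw [LinearPMap.map_smul, hu2]
  refine ⟨ι, e, fun k => (ν k)⁻¹, c, hc0, fun k => ?_, heig⟩
  obtain ⟨u, hu1, hu2⟩ := heig k
  have := hc u
  rw [hu2, hu1, real_inner_smul_left, real_inner_self_eq_norm_sq, e.orthonormal.1 k] at this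
  simpa using this

end Spectral

/-! ### The system of modes and the energy inequality -/

section Energy

variable {H : Type*} [NormedAddCommGroup H]

/-- The squared Hilbertian norm of `(x, v, θ)`. -/
def energy (U : H × H × H) : ℝ := ‖U.1‖ ^ 2 + ‖U.2.1‖ ^ 2 + ‖U.2.2‖ ^ 2

theorem energy_nonneg (U : H × H × H) : 0 ≤ energy U := by unfold energy; positivity

theorem continuous_energy : Continuous (energy : H × H × H → ℝ) := by unfold energy; fun_prop

theorem norm_sq_le_energy (U : H × H × H) : ‖U‖ ^ 2 ≤ energy U := by
  have h1 := sq_nonneg ‖U.1‖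
  have h2 := sq_nonneg ‖U.2.1‖
  have h3 := sq_nonneg ‖U.2.2‖
  unfold energy
  rw [Prod.norm_def, Prod.norm_def]
  rcases max_choice ‖U.1‖ (max ‖U.2.1‖ ‖U.2.2‖) with h | h <;> rw [h]
  · linarith
  · rcases max_choice ‖U.2.1‖ ‖U.2.2‖ with h | h <;> rw [h] <;> linarith

theorem energy_le_norm_sq (U : H × H × H) : energy U ≤ 3 * ‖U‖ ^ 2 := by
  have h1 : ‖U.1‖ ≤ ‖U‖ := norm_fst_le U
  have h2 : ‖U.2.1‖ ≤ ‖U‖ := (norm_fst_le U.2).trans (norm_snd_le U)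
  have h3 : ‖U.2.2‖ ≤ ‖U‖ := (norm_snd_le U.2).trans (norm_snd_le U)
  have h1' := pow_le_pow_left₀ (norm_nonneg _) h1 2
  have h2' := pow_le_pow_left₀ (norm_nonneg _) h2 2
  have h3' := pow_le_pow_left₀ (norm_nonneg _) h3 2
  unfold energy
  linarith

end Energy

section Modes

variable {H : Type*} [NormedAddCommGroup H] [InnerProductSpace ℝ H] {ι : Type*}

/-- The squared length of the `k`-th coefficients of `(x, v, θ)`. -/
def modeEnergy (e : HilbertBasis ι ℝ H) (k : ι) (U : H × H × H) : ℝ :=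
  inner ℝ (e k) U.1 ^ 2 + inner ℝ (e k) U.2.1 ^ 2 + inner ℝ (e k) U.2.2 ^ 2

theorem modeEnergy_nonneg (e : HilbertBasis ι ℝ H) (k : ι) (U : H × H × H) :
    0 ≤ modeEnergy e k U := by unfold modeEnergy; positivity

theorem continuous_modeEnergy (e : HilbertBasis ι ℝ H) (k : ι) :
    Continuous (modeEnergy e k : H × H × H → ℝ) := by unfold modeEnergy; fun_prop

theorem hasSum_modeEnergy (e : HilbertBasis ι ℝ H) (U : H × H × H) :
    HasSum (fun k => modeEnergy e k U) (energy U) :=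
  ((hasSum_coef_sq e U.1).add (hasSum_coef_sq e U.2.1)).add (hasSum_coef_sq e U.2.2)

theorem sum_modeEnergy_le (e : HilbertBasis ι ℝ H) (s : Finset ι) (U : H × H × H) :
    ∑ k ∈ s, modeEnergy e k U ≤ energy U :=
  sum_le_hasSum s (fun _ _ => modeEnergy_nonneg e _ U) (hasSum_modeEnergy e U)

/-- `U = (x, v, θ)` is continuous and on the open interval `(0, T)` its coefficients solve
`x' = μ v`, `v' = μ (θ - x) + n`, `θ' = -μ (θ + v) + m`. Here `x = A ^ (1/2) u`, `v = u'`, and `μ`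
runs over the eigenvalues of `A ^ (1/2)`. -/
structure ModeSol (e : HilbertBasis ι ℝ H) (μ : ι → ℝ) (n m : ℝ → H) (T : ℝ)
    (U : ℝ → H × H × H) : Prop where
  cont : Continuous U
  deriv_x : ∀ k, ∀ t ∈ Ioo 0 T,
    HasDerivAt (fun s => inner ℝ (e k) (U s).1) (μ k * inner ℝ (e k) (U t).2.1) t
  deriv_v : ∀ k, ∀ t ∈ Ioo 0 T,
    HasDerivAt (fun s => inner ℝ (e k) (U s).2.1)
      (μ k * (inner ℝ (e k) (U t).2.2 - inner ℝ (e k) (U t).1) + inner ℝ (e k) (n t)) t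
  deriv_θ : ∀ k, ∀ t ∈ Ioo 0 T,
    HasDerivAt (fun s => inner ℝ (e k) (U s).2.2)
      (-(μ k * (inner ℝ (e k) (U t).2.2 + inner ℝ (e k) (U t).2.1)) + inner ℝ (e k) (m t)) t

namespace ModeSol

variable {e : HilbertBasis ι ℝ H} {μ : ι → ℝ} {n m : ℝ → H} {T : ℝ} {U : ℝ → H × H × H}

theorem sub {n' m' : ℝ → H} {V : ℝ → H × H × H} (hU : ModeSol e μ n m T U)
    (hV : ModeSol e μ n' m' T V) : ModeSol e μ (n - n') (m - m') T (U - V) where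
  cont := hU.cont.sub hV.cont
  deriv_x k t ht := by
    have h := (hU.deriv_x k t ht).sub (hV.deriv_x k t ht)
    simp only [Pi.sub_apply, Prod.fst_sub, Prod.snd_sub, inner_sub_right]
    exact h.congr_deriv (by ring)
  deriv_v k t ht := by
    have h := (hU.deriv_v k t ht).sub (hV.deriv_v k t ht)
    simp only [Pi.sub_apply, Prod.fst_sub, Prod.snd_sub, inner_sub_right]
    exact h.congr_deriv (by ring)
  deriv_θ k t ht := by
    have h := (hU.deriv_θ k t ht).sub (hV.deriv_θ k t ht)
    simp only [Pi.sub_apply, Prod.fst_sub, Prod.snd_sub, inner_sub_right]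
    exact h.congr_deriv (by ring)

theorem mono (hU : ModeSol e μ n m T U) {T' : ℝ} (h : T' ≤ T) : ModeSol e μ n m T' U where
  cont := hU.cont
  deriv_x k t ht := hU.deriv_x k t ⟨ht.1, ht.2.trans_le h⟩
  deriv_v k t ht := hU.deriv_v k t ⟨ht.1, ht.2.trans_le h⟩
  deriv_θ k t ht := hU.deriv_θ k t ⟨ht.1, ht.2.trans_le h⟩

theorem hasDerivAt_modeEnergy (hU : ModeSol e μ n m T U) (k : ι) {t : ℝ} (ht : t ∈ Ioo 0 T) :
    HasDerivAt (fun s => modeEnergy e k (U s))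
      (2 * (inner ℝ (e k) (n t) * inner ℝ (e k) (U t).2.1
        + inner ℝ (e k) (m t) * inner ℝ (e k) (U t).2.2
        - μ k * inner ℝ (e k) (U t).2.2 ^ 2)) t := by
  have h := (((hU.deriv_x k t ht).pow 2).add ((hU.deriv_v k t ht).pow 2)).add
    ((hU.deriv_θ k t ht).pow 2)
  exact h.congr_deriv (by push_cast; ring)

/-- The energy inequality: the principal part of the system is dissipative, so the energy grows
only through the forcing. It is proved for finitely many modes, and the estimate for the whole
sum follows since its right-hand side does not depend on the set of modes. -/
theorem energy_le_integral (hU : ModeSol e μ n m T U) (hμ : ∀ k, 0 ≤ μ k) {a d : ℝ}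
    (hnm : ∀ t ∈ Ioo 0 T, 2 * (‖n t‖ * ‖(U t).2.1‖ + ‖m t‖ * ‖(U t).2.2‖)
      ≤ a * energy (U t) + d) {t : ℝ} (ht : t ∈ Icc 0 T) :
    energy (U t) ≤ energy (U 0) + ∫ τ in (0 : ℝ)..t, (a * energy (U τ) + d) := by
  have hcont : Continuous fun τ => a * energy (U τ) + d :=
    (continuous_const.mul (continuous_energy.comp hU.cont)).add continuous_const
  refine hasSum_le_of_sum_le (hasSum_modeEnergy e (U t)) fun s => ?_
  have hanti : AntitoneOn (fun t => (∑ k ∈ s, modeEnergy e k (U t))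
      - ∫ τ in (0 : ℝ)..t, (a * energy (U τ) + d)) (Icc 0 T) := by
    refine antitoneOn_of_hasDerivWithinAt_nonpos (convex_Icc 0 T)
      (f' := fun t => (∑ k ∈ s, 2 * (inner ℝ (e k) (n t) * inner ℝ (e k) (U t).2.1
        + inner ℝ (e k) (m t) * inner ℝ (e k) (U t).2.2
        - μ k * inner ℝ (e k) (U t).2.2 ^ 2)) - (a * energy (U t) + d)) ?_ ?_ ?_
    · refine Continuous.continuousOn (Continuous.sub ?_ ?_)
      · exact continuous_finsetSum _ fun k _ => (continuous_modeEnergy e k).comp hU.cont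
      · exact intervalIntegral.continuous_primitive (fun _ _ => hcont.intervalIntegrable _ _) _
    · rw [interior_Icc]
      intro t ht
      refine HasDerivAt.hasDerivWithinAt (HasDerivAt.sub ?_ ?_)
      · exact HasDerivAt.fun_sum fun k _ => hU.hasDerivAt_modeEnergy k ht
      · exact (hcont.integral_hasStrictDerivAt 0 t).hasDerivAt
    · rw [interior_Icc]
      intro t ht
      have h1 := sum_coef_mul_le e s (n t) (U t).2.1
      have h2 := sum_coef_mul_le e s (m t) (U t).2.2
      have h3 : 0 ≤ ∑ k ∈ s, μ k * inner ℝ (e k) (U t).2.2 ^ 2 :=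
        Finset.sum_nonneg fun k _ => mul_nonneg (hμ k) (sq_nonneg _)
      have h4 := hnm t ht
      rw [← Finset.mul_sum, Finset.sum_sub_distrib, Finset.sum_add_distrib]
      linarith
  have h := hanti (left_mem_Icc.2 (ht.1.trans ht.2)) ht ht.1
  simp only [intervalIntegral.integral_same, sub_zero] at h
  linarith [sum_modeEnergy_le e s (U 0)]

/-- The energy inequality combined with Grönwall's lemma. -/
theorem energy_le (hU : ModeSol e μ n m T U) (hμ : ∀ k, 0 ≤ μ k) {a d : ℝ} (ha : 0 ≤ a)
    (hd : 0 ≤ d)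
    (hnm : ∀ t ∈ Ioo 0 T, 2 * (‖n t‖ * ‖(U t).2.1‖ + ‖m t‖ * ‖(U t).2.2‖)
      ≤ a * energy (U t) + d) {t : ℝ} (ht : t ∈ Icc 0 T) :
    energy (U t) ≤ (energy (U 0) + d * t) * Real.exp (a * t) := by
  have hcont : Continuous fun τ => a * energy (U τ) + d :=
    (continuous_const.mul (continuous_energy.comp hU.cont)).add continuous_const
  set Y : ℝ → ℝ := fun t => energy (U 0) + ∫ τ in (0 : ℝ)..t, (a * energy (U τ) + d) with hY
  have hEY : ∀ t ∈ Icc 0 T, energy (U t) ≤ Y t := fun t ht => hU.energy_le_integral hμ hnm ht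
  have hYd : ∀ t, HasDerivAt Y (a * energy (U t) + d) t := fun t =>
    (hcont.integral_hasStrictDerivAt 0 t).hasDerivAt.const_add _
  have hZd : ∀ t, HasDerivAt (fun t => Real.exp (-(a * t)) * Y t - d * t)
      (Real.exp (-(a * t)) * (a * energy (U t) + d - a * Y t) - d) t := by
    intro t
    have h := ((((hasDerivAt_id t).const_mul a).neg.exp).mul (hYd t)).sub
      ((hasDerivAt_id t).const_mul d)
    exact h.congr_deriv (by simp; ring)
  have hanti : AntitoneOn (fun t => Real.exp (-(a * t)) * Y t - d * t) (Icc 0 T) := by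
    refine antitoneOn_of_hasDerivWithinAt_nonpos (convex_Icc 0 T)
      (fun t _ => (hZd t).continuousAt.continuousWithinAt)
      (fun t _ => (hZd t).hasDerivWithinAt) ?_
    rw [interior_Icc]
    intro t ht
    have h1 := hEY t (Ioo_subset_Icc_self ht)
    have h2 : Real.exp (-(a * t)) ≤ 1 := Real.exp_le_one_iff.2 (by nlinarith [ht.1])
    have h3 := Real.exp_pos (-(a * t))
    have h4 : Real.exp (-(a * t)) * (a * energy (U t) + d - a * Y t)
        ≤ Real.exp (-(a * t)) * d :=
      mul_le_mul_of_nonneg_left (by nlinarith) h3.le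
    nlinarith
  have h := hanti (left_mem_Icc.2 (ht.1.trans ht.2)) ht ht.1
  have hY0 : Y 0 = energy (U 0) := by simp [hY]
  simp only [hY0, mul_zero, neg_zero, Real.exp_zero, one_mul, sub_zero] at h
  refine (hEY t ht).trans ?_
  have h5 : Y t = Real.exp (-(a * t)) * Y t * Real.exp (a * t) := by
    rw [mul_right_comm, ← Real.exp_add]
    simp
  rw [h5]
  exact mul_le_mul_of_nonneg_right (by linarith) (Real.exp_pos _).le

end ModeSol

end Modes

/-! ### A Carleman estimate and backward uniqueness -/

section Carleman

/-- The characteristic polynomial of the matrix of a mode has three distinct complex roots. -/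
theorem exists_roots : ∃ r : Fin 3 → ℂ, Function.Injective r ∧
    ∀ j, r j ^ 3 + r j ^ 2 + 2 * r j + 1 = 0 := by
  obtain ⟨a, -, ha⟩ : ∃ a ∈ Icc (-1 : ℝ) 0, a ^ 3 + a ^ 2 + 2 * a + 1 = 0 := by
    have h := intermediate_value_Icc (by norm_num : (-1 : ℝ) ≤ 0)
      (f := fun a : ℝ => a ^ 3 + a ^ 2 + 2 * a + 1) (by fun_prop)
    exact h ⟨by norm_num, by norm_num⟩
  set d : ℝ := Real.sqrt (3 * a ^ 2 + 2 * a + 7) with hd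
  have hd0 : 0 < 3 * a ^ 2 + 2 * a + 7 := by nlinarith [sq_nonneg (3 * a + 1)]
  have hdpos : 0 < d := Real.sqrt_pos.2 hd0
  have hd2 : d ^ 2 = 3 * a ^ 2 + 2 * a + 7 := Real.sq_sqrt hd0.le
  have hd2' : (d : ℂ) ^ 2 = 3 * (a : ℂ) ^ 2 + 2 * a + 7 := by exact_mod_cast hd2
  have ha' : (a : ℂ) ^ 3 + (a : ℂ) ^ 2 + 2 * a + 1 = 0 := by exact_mod_cast ha
  have hI := Complex.I_sq
  -- dividing out the real root `a` leaves a quadratic polynomial with discriminant `-d ^ 2`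
  have hquad : ∀ z : ℂ, z ^ 2 + (1 + a) * z + (a ^ 2 + a + 2) = 0 →
      z ^ 3 + z ^ 2 + 2 * z + 1 = 0 := by
    intro z hz
    linear_combination (z - a) * hz + ha'
  refine ⟨![(a : ℂ), (-(1 + a) + d * Complex.I) / 2, (-(1 + a) - d * Complex.I) / 2], ?_, ?_⟩
  · have h01 : (a : ℂ) ≠ (-(1 + a) + d * Complex.I) / 2 := by
      intro h
      have := congrArg Complex.im h
      simp at this
      linarith
    have h02 : (a : ℂ) ≠ (-(1 + a) - d * Complex.I) / 2 := by
      intro h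
      have := congrArg Complex.im h
      simp at this
      linarith
    have h12 : (-(1 + a) + d * Complex.I) / 2 ≠ (-(1 + a) - d * Complex.I) / 2 := by
      intro h
      have := congrArg Complex.im h
      simp at this
      linarith
    intro i j hij
    fin_cases i <;> fin_cases j <;> simp_all
  · intro j
    fin_cases j
    · exact ha'
    · apply hquad
      simp only [Fin.mk_one, Matrix.cons_val_one, Matrix.cons_val_zero]
      linear_combination (d : ℂ) ^ 2 / 4 * hI - hd2' / 4
    · apply hquad
      simp only [Fin.reduceFinMk, Matrix.cons_val]
      linear_combination (d : ℂ) ^ 2 / 4 * hI - hd2' / 4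

/-- The left eigenvector of the matrix of a mode for the eigenvalue `r`, as a linear form. -/
def eigenForm (r : ℂ) (p : ℝ × ℝ × ℝ) : ℂ :=
  p.1 + r * (p.1 - p.2.1 - p.2.2) - r ^ 2 * p.2.1

/-- Three eigenvectors for distinct eigenvalues form a coordinate system. -/
theorem exists_eigenForm_bounds {r : Fin 3 → ℂ} (hr : Function.Injective r) :
    ∃ c C : ℝ, 0 < c ∧ 0 < C ∧ ∀ p : ℝ × ℝ × ℝ,
      c * energy p ≤ ∑ j, ‖eigenForm (r j) p‖ ^ 2 ∧
      ∑ j, ‖eigenForm (r j) p‖ ^ 2 ≤ C * energy p := by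
  let L : (ℝ × ℝ × ℝ) →ₗ[ℝ] (Fin 3 → ℂ) :=
    { toFun := fun p j => eigenForm (r j) p
      map_add' := fun p q => by
        funext j; simp [eigenForm]; ring
      map_smul' := fun a p => by
        funext j; simp [eigenForm]; ring }
  have hL : ∀ p j, L p j = eigenForm (r j) p := fun _ _ => rfl
  have hker : LinearMap.ker L = ⊥ := by
    rw [LinearMap.ker_eq_bot']
    intro p hp
    have h : ∀ j, eigenForm (r j) p = 0 := fun j => congrFun hp j
    have h01 : r 0 - r 1 ≠ 0 := sub_ne_zero.2 (hr.ne (by decide))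
    have h02 : r 0 - r 2 ≠ 0 := sub_ne_zero.2 (hr.ne (by decide))
    have h12 : r 1 - r 2 ≠ 0 := sub_ne_zero.2 (hr.ne (by decide))
    have h0 := h 0
    have h1 := h 1
    have h2 := h 2
    simp only [eigenForm] at h0 h1 h2
    have e1 : ((p.1 : ℂ) - p.2.1 - p.2.2) - (r 0 + r 1) * p.2.1 = 0 := by
      apply mul_left_cancel₀ h01
      linear_combination h0 - h1
    have e2 : ((p.1 : ℂ) - p.2.1 - p.2.2) - (r 0 + r 2) * p.2.1 = 0 := by
      apply mul_left_cancel₀ h02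
      linear_combination h0 - h2
    have e3 : (p.2.1 : ℂ) = 0 := by
      apply mul_left_cancel₀ h12
      linear_combination e2 - e1
    have e4 : (p.1 : ℂ) = 0 := by
      rw [e3] at e1 h0
      linear_combination h0 - r 0 * e1
    have e5 : (p.2.2 : ℂ) = 0 := by
      rw [e3, e4] at e1
      linear_combination -e1
    exact Prod.ext (by exact_mod_cast e4)
      (Prod.ext (by exact_mod_cast e3) (by exact_mod_cast e5))
  obtain ⟨K, hK0, hK⟩ := L.exists_antilipschitzWith hker
  have hK' : ∀ p, ‖p‖ ≤ K * ‖L p‖ := fun p => hK.le_mul_norm (map_zero L) p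
  let Lc := LinearMap.toContinuousLinearMap L
  have hKpos : (0 : ℝ) < K := hK0
  refine ⟨(3 * (K : ℝ) ^ 2)⁻¹, 3 * (‖Lc‖ + 1) ^ 2, by positivity, by positivity, fun p => ⟨?_, ?_⟩⟩
  · have h1 : ‖L p‖ ^ 2 ≤ ∑ j, ‖eigenForm (r j) p‖ ^ 2 := by
      have h0 : (0 : ℝ) ≤ ∑ j, ‖eigenForm (r j) p‖ ^ 2 :=
        Finset.sum_nonneg fun _ _ => sq_nonneg _
      have h2 : ‖L p‖ ≤ Real.sqrt (∑ j, ‖eigenForm (r j) p‖ ^ 2) := by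
        rw [pi_norm_le_iff_of_nonneg (Real.sqrt_nonneg _)]
        intro j
        apply Real.le_sqrt_of_sq_le
        rw [hL]
        exact Finset.single_le_sum (f := fun j => ‖eigenForm (r j) p‖ ^ 2)
          (fun _ _ => sq_nonneg _) (Finset.mem_univ j)
      calc ‖L p‖ ^ 2 ≤ Real.sqrt (∑ j, ‖eigenForm (r j) p‖ ^ 2) ^ 2 := by gcongr
        _ = _ := Real.sq_sqrt h0
    have h2 := energy_le_norm_sq p
    have h3 : ‖p‖ ^ 2 ≤ (K : ℝ) ^ 2 * ‖L p‖ ^ 2 := by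
      rw [← mul_pow]
      exact pow_le_pow_left₀ (norm_nonneg _) (hK' p) 2
    rw [inv_mul_le_iff₀ (by positivity)]
    nlinarith [mul_le_mul_of_nonneg_left h1 (sq_nonneg (K : ℝ))]
  · have h1 : ∀ j, ‖eigenForm (r j) p‖ ^ 2 ≤ (‖Lc‖ + 1) ^ 2 * energy p := by
      intro j
      have h2 : ‖eigenForm (r j) p‖ ≤ (‖Lc‖ + 1) * ‖p‖ := by
        have h3 : ‖Lc p‖ ≤ ‖Lc‖ * ‖p‖ := Lc.le_opNorm p
        have h4 : ‖eigenForm (r j) p‖ ≤ ‖Lc p‖ := norm_le_pi_norm (L p) j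
        nlinarith [norm_nonneg p]
      calc ‖eigenForm (r j) p‖ ^ 2 ≤ ((‖Lc‖ + 1) * ‖p‖) ^ 2 :=
            pow_le_pow_left₀ (norm_nonneg _) h2 2
        _ = (‖Lc‖ + 1) ^ 2 * ‖p‖ ^ 2 := by ring
        _ ≤ _ := mul_le_mul_of_nonneg_left (norm_sq_le_energy p) (sq_nonneg _)
    calc ∑ j, ‖eigenForm (r j) p‖ ^ 2 ≤ ∑ _j : Fin 3, (‖Lc‖ + 1) ^ 2 * energy p :=
          Finset.sum_le_sum fun j _ => h1 j
      _ = _ := by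
        rw [Finset.sum_const, Finset.card_univ, Fintype.card_fin, nsmul_eq_mul]; push_cast; ring

/-- A Carleman estimate for the scalar equation `y' = lam y + h` with `y T = 0`, uniform in the
complex number `lam`. With the cutoff `t`, the function `w = t e ^ (s t ² / 2) y` vanishes at both
ends of `[0, T]` and solves `w' = (s t + lam) w + F`, where `F = e ^ (s t ² / 2) (t h + y)`; the
estimate results from integrating the derivative of `(s t + re lam) |w| ²`. -/
theorem carleman_scalar {y h : ℝ → ℂ} {lam : ℂ} {T : ℝ} (s : ℝ) (hT : 0 ≤ T) (hy : Continuous y)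
    (hh : Continuous h) (hd : ∀ t ∈ Ioo 0 T, HasDerivAt y (lam * y t + h t) t) (hyT : y T = 0) :
    s * ∫ t in (0 : ℝ)..T, Real.exp (s * t ^ 2) * t ^ 2 * ‖y t‖ ^ 2
      ≤ ∫ t in (0 : ℝ)..T, Real.exp (s * t ^ 2) * (t ^ 2 * ‖h t‖ ^ 2 + ‖y t‖ ^ 2) := by
  have hc2 : Continuous fun t : ℝ =>
    Real.exp (s * t ^ 2) * (t ^ 2 * ‖h t‖ ^ 2 + ‖y t‖ ^ 2) := by fun_prop
  rw [← sub_nonpos, ← intervalIntegral.integral_const_mul, ← intervalIntegral.integral_sub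
    (Continuous.intervalIntegrable (by fun_prop) _ _) (hc2.intervalIntegrable _ _)]
  set ψ : ℝ → ℝ := fun t => (s * t + lam.re) * (t ^ 2 * Real.exp (s * t ^ 2)) * ‖y t‖ ^ 2 with hψ
  have hψd : ∀ t ∈ Ioo 0 T, HasDerivAt ψ
      ((s * (t ^ 2 * Real.exp (s * t ^ 2)) + (s * t + lam.re) *
        (2 * t * Real.exp (s * t ^ 2) + t ^ 2 * (Real.exp (s * t ^ 2) * (s * (2 * t))))) * ‖y t‖ ^ 2
        + (s * t + lam.re) * (t ^ 2 * Real.exp (s * t ^ 2)) *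
          (2 * inner ℝ (y t) (lam * y t + h t))) t := by
    intro t ht
    have h1 : HasDerivAt (fun t : ℝ => s * t + lam.re) s t :=
      (((hasDerivAt_id t).const_mul s).add_const _).congr_deriv (by simp)
    have h2 : HasDerivAt (fun t : ℝ => t ^ 2) (2 * t) t :=
      (hasDerivAt_pow 2 t).congr_deriv (by simp)
    exact ((h1.mul (h2.mul (h2.const_mul s).exp)).mul (hd t ht).norm_sq)
  have hle := intervalIntegral.integral_le_sub_of_hasDeriv_right_of_le hT
    (g := ψ) (φ := fun t => s * (Real.exp (s * t ^ 2) * t ^ 2 * ‖y t‖ ^ 2)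
      - Real.exp (s * t ^ 2) * (t ^ 2 * ‖h t‖ ^ 2 + ‖y t‖ ^ 2))
    (Continuous.continuousOn (by fun_prop)) (fun t ht => (hψd t ht).hasDerivWithinAt)
    (Continuous.integrableOn_Icc (by fun_prop)) (fun t _ => ?_)
  · refine hle.trans (le_of_eq ?_)
    simp [hψ, hyT]
  · -- after division by the exponential, the difference of the two sides is half of
    -- `‖(2 (s t + re lam) t + 1) y + t h‖² + ‖y - t h‖²`
    have hE := Real.exp_pos (s * t ^ 2)
    have hin : inner ℝ (y t) (lam * y t + h t) = lam.re * ‖y t‖ ^ 2 + inner ℝ (y t) (h t) := by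
      rw [inner_add_right, Complex.inner, Complex.sq_norm, Complex.normSq_apply]
      simp
      ring
    have hsq : 0 ≤ ‖((2 * (s * t + lam.re) * t + 1 : ℝ)) • y t + t • h t‖ ^ 2 := sq_nonneg _
    have hpar : 0 ≤ ‖y t - t • h t‖ ^ 2 := sq_nonneg _
    rw [@norm_add_sq ℝ, norm_smul, norm_smul, real_inner_smul_left, real_inner_smul_right, mul_pow,
      mul_pow, Real.norm_eq_abs, Real.norm_eq_abs, sq_abs, sq_abs] at hsq
    rw [@norm_sub_sq ℝ, norm_smul, real_inner_smul_right, mul_pow, Real.norm_eq_abs, sq_abs] at hpar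
    simp only [RCLike.re_to_real] at hsq hpar
    rw [hin]
    nlinarith [mul_nonneg hE.le hsq, mul_nonneg hE.le hpar]

/-- A nonnegative continuous function which satisfies the inequality that the Carleman estimate
yields, for every value of the large parameter, vanishes. -/
theorem eq_zero_of_weighted_integral_nonpos {p : ℝ → ℝ} {T K C : ℝ} (hT : 0 < T) (hK : 0 ≤ K)
    (hC : 0 ≤ C) (hp : Continuous p) (hp0 : ∀ t, 0 ≤ p t)
    (h : ∀ s : ℝ, 0 ≤ s →
      ∫ t in (0 : ℝ)..T, Real.exp (s * t ^ 2) * (((s - K) * t ^ 2 - C) * p t) ≤ 0) :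
    ∀ t ∈ Ioc 0 T, p t = 0 := by
  set q : ℝ → ℝ := fun t => Real.exp (K * t ^ 2) * p t with hq
  have hqc : Continuous q := by fun_prop
  have hq0 : ∀ t, 0 ≤ q t := fun t => mul_nonneg (Real.exp_pos _).le (hp0 t)
  set C' := C + C * Real.exp C with hC'
  -- for `τ ≤ C` the right-hand side is at least `-C e ^ C`, which `C'` absorbs
  have hexp : ∀ τ : ℝ, 0 ≤ τ → τ - C' ≤ Real.exp τ * (τ - C) := by
    intro τ hτ
    rcases le_total C τ with hle | hle
    · have h1 : 1 ≤ Real.exp τ := Real.one_le_exp hτ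
      have h2 : 0 ≤ C * Real.exp C := by positivity
      nlinarith
    · have h1 : Real.exp τ ≤ Real.exp C := Real.exp_le_exp.2 hle
      have h2 := Real.exp_pos τ
      have h3 := Real.exp_pos C
      nlinarith
  have hI : ∀ σ : ℝ, 0 ≤ σ →
      σ * (∫ t in (0 : ℝ)..T, t ^ 2 * q t) ≤ C' * ∫ t in (0 : ℝ)..T, q t := by
    intro σ hσ
    have h1 : ∫ t in (0 : ℝ)..T, (σ * (t ^ 2 * q t) - C' * q t) ≤ 0 := by
      refine le_trans ?_ (h (σ + K) (by positivity))
      refine intervalIntegral.integral_mono_on hT.le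
        (Continuous.intervalIntegrable (by fun_prop) _ _)
        (Continuous.intervalIntegrable (by fun_prop) _ _) fun t _ => ?_
      have h2 := mul_le_mul_of_nonneg_right (hexp (σ * t ^ 2) (by positivity)) (hq0 t)
      have h3 : Real.exp ((σ + K) * t ^ 2) = Real.exp (σ * t ^ 2) * Real.exp (K * t ^ 2) := by
        rw [← Real.exp_add]; ring_nf
      rw [h3]
      calc σ * (t ^ 2 * q t) - C' * q t = (σ * t ^ 2 - C') * q t := by ring
        _ ≤ _ := h2
        _ = _ := by simp only [hq]; ring
    rw [intervalIntegral.integral_sub (Continuous.intervalIntegrable (by fun_prop) _ _)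
      (Continuous.intervalIntegrable (by fun_prop) _ _), intervalIntegral.integral_const_mul,
      intervalIntegral.integral_const_mul] at h1
    linarith
  have hI0 : ∫ t in (0 : ℝ)..T, t ^ 2 * q t ≤ 0 := by
    by_contra! hpos
    obtain ⟨N, hN⟩ := exists_nat_gt ((C' * ∫ t in (0 : ℝ)..T, q t) / ∫ t in (0 : ℝ)..T, t ^ 2 * q t)
    rw [div_lt_iff₀ hpos] at hN
    linarith [hI N (Nat.cast_nonneg N)]
  intro t ht
  by_contra hne
  have hlt : 0 < q t := mul_pos (Real.exp_pos _) (lt_of_le_of_ne (hp0 t) (Ne.symm hne))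
  have : 0 < ∫ t in (0 : ℝ)..T, t ^ 2 * q t :=
    intervalIntegral.integral_pos hT (Continuous.continuousOn (by fun_prop))
      (fun x _ => mul_nonneg (sq_nonneg _) (hq0 x))
      ⟨t, ⟨ht.1.le, ht.2⟩, mul_pos (pow_pos ht.1 2) hlt⟩
  linarith

variable {H : Type*} [NormedAddCommGroup H] [InnerProductSpace ℝ H] {ι : Type*}
  {e : HilbertBasis ι ℝ H} {μ : ι → ℝ} {n : ℝ → H} {T : ℝ} {U : ℝ → H × H × H}

theorem energy_coef (e : HilbertBasis ι ℝ H) (k : ι) (U : H × H × H) :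
    energy ((inner ℝ (e k) U.1 : ℝ), (inner ℝ (e k) U.2.1 : ℝ), (inner ℝ (e k) U.2.2 : ℝ))
      = modeEnergy e k U := by
  simp [energy, modeEnergy]

theorem ModeSol.hasDerivAt_eigenForm (hU : ModeSol e μ n 0 T U) {r : ℂ}
    (hr : r ^ 3 + r ^ 2 + 2 * r + 1 = 0) (k : ι) {t : ℝ} (ht : t ∈ Ioo 0 T) :
    HasDerivAt (fun s => eigenForm r
        (inner ℝ (e k) (U s).1, inner ℝ (e k) (U s).2.1, inner ℝ (e k) (U s).2.2))
      ((μ k * r) * eigenForm r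
        (inner ℝ (e k) (U t).1, inner ℝ (e k) (U t).2.1, inner ℝ (e k) (U t).2.2)
        + -(r + r ^ 2) * (inner ℝ (e k) (n t) : ℝ)) t := by
  have hx := (hU.deriv_x k t ht).ofReal_comp
  have hv := (hU.deriv_v k t ht).ofReal_comp
  have hθ := (hU.deriv_θ k t ht).ofReal_comp
  have h := (hx.add (((hx.sub hv).sub hθ).const_mul r)).sub (hv.const_mul (r ^ 2))
  refine h.congr_deriv ?_
  simp only [eigenForm, Pi.zero_apply, inner_zero_right]
  push_cast
  linear_combination ((μ k : ℂ) * (inner ℝ (e k) (U t).2.1 : ℝ)) * hr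

theorem sum_sum_integral {κ : Type*} [Fintype κ] (S : Finset ι) {F : ι → κ → ℝ → ℝ}
    (hF : ∀ k j, Continuous (F k j)) {a b : ℝ} :
    ∑ k ∈ S, ∑ j, ∫ t in a..b, F k j t = ∫ t in a..b, ∑ k ∈ S, ∑ j, F k j t := by
  rw [intervalIntegral.integral_finsetSum fun k _ =>
    (continuous_finsetSum _ fun j _ => hF k j).intervalIntegrable _ _]
  refine Finset.sum_congr rfl fun k _ => ?_
  rw [intervalIntegral.integral_finsetSum fun j _ => (hF k j).intervalIntegrable _ _]

/-- The index set is countable, so that dominated convergence applies along its finite subsets. -/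
theorem tendsto_integral_sum_modeEnergy [Countable ι] {w : ℝ → ℝ} (hw : Continuous w)
    (hU : Continuous U) :
    Tendsto (fun S : Finset ι => ∫ t in (0 : ℝ)..T, w t * ∑ k ∈ S, modeEnergy e k (U t)) atTop
      (𝓝 (∫ t in (0 : ℝ)..T, w t * energy (U t))) := by
  refine intervalIntegral.tendsto_integral_filter_of_dominated_convergence
    (fun t => |w t| * energy (U t)) ?_ ?_ ?_ ?_
  · refine Eventually.of_forall fun S => Continuous.aestronglyMeasurable ?_
    exact hw.mul (continuous_finsetSum _ fun k _ => (continuous_modeEnergy e k).comp hU)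
  · refine Eventually.of_forall fun S => Eventually.of_forall fun t _ => ?_
    rw [norm_mul, Real.norm_eq_abs, Real.norm_eq_abs, abs_of_nonneg
      (Finset.sum_nonneg fun k _ => modeEnergy_nonneg e k (U t))]
    exact mul_le_mul_of_nonneg_left (sum_modeEnergy_le e S (U t)) (abs_nonneg _)
  · exact (hw.abs.mul (continuous_energy.comp hU)).intervalIntegrable _ _
  · exact Eventually.of_forall fun t _ => (hasSum_modeEnergy e (U t)).const_mul _

/-- Backward uniqueness: a solution of the system of modes, with a forcing of the second equation
that is dominated by the solution, is zero on `[0, T]` if it is zero at time `T`. The Carleman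
estimate is applied to each eigencomponent of each mode, and summed. -/
theorem ModeSol.eq_zero_of_eq_zero_end [Countable ι] (hU : ModeSol e μ n 0 T U) (hT : 0 < T)
    (hn : Continuous n) {K : ℝ} (hK : 0 ≤ K) (hnU : ∀ t ∈ Icc 0 T, ‖n t‖ ^ 2 ≤ K * energy (U t))
    (hUT : U T = 0) : U 0 = 0 := by
  obtain ⟨r, hrinj, hr⟩ := exists_roots
  obtain ⟨c, C, hc, hC, hcC⟩ := exists_eigenForm_bounds hrinj
  set y : ι → Fin 3 → ℝ → ℂ := fun k j t => eigenForm (r j)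
    (inner ℝ (e k) (U t).1, inner ℝ (e k) (U t).2.1, inner ℝ (e k) (U t).2.2) with hy
  have hUc := hU.cont
  have hyc : ∀ k j, Continuous (y k j) := by
    intro k j
    simp only [hy, eigenForm]
    fun_prop
  set M := ∑ j, ‖-(r j + r j ^ 2)‖ ^ 2 with hM
  have hM0 : 0 ≤ M := Finset.sum_nonneg fun _ _ => sq_nonneg _
  -- the Carleman estimate for finitely many modes
  have hfin : ∀ (s : ℝ), 0 ≤ s → ∀ (S : Finset ι),
      s * c * ∫ t in (0 : ℝ)..T, Real.exp (s * t ^ 2) * t ^ 2 * ∑ k ∈ S, modeEnergy e k (U t)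
        ≤ ∫ t in (0 : ℝ)..T, Real.exp (s * t ^ 2) * ((M * K) * t ^ 2 + C) * energy (U t) := by
    intro s hs S
    have h1 : ∀ k j, s * ∫ t in (0 : ℝ)..T, Real.exp (s * t ^ 2) * t ^ 2 * ‖y k j t‖ ^ 2
        ≤ ∫ t in (0 : ℝ)..T, Real.exp (s * t ^ 2) *
          (t ^ 2 * ‖-(r j + r j ^ 2) * (inner ℝ (e k) (n t) : ℝ)‖ ^ 2 + ‖y k j t‖ ^ 2) := by
      intro k j
      refine carleman_scalar s hT.le (hyc k j) (by fun_prop)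
        (fun t ht => hU.hasDerivAt_eigenForm (hr j) k ht) ?_
      simp [hy, hUT, eigenForm]
    have h2 := Finset.sum_le_sum fun k (_ : k ∈ S) => Finset.sum_le_sum
      fun j (_ : j ∈ Finset.univ) => h1 k j
    simp only [← Finset.mul_sum] at h2
    rw [sum_sum_integral S fun k j => by have := hyc k j; fun_prop,
      sum_sum_integral S fun k j => by have := hyc k j; fun_prop] at h2
    have hyE : ∀ k t, c * modeEnergy e k (U t) ≤ ∑ j, ‖y k j t‖ ^ 2 ∧
        ∑ j, ‖y k j t‖ ^ 2 ≤ C * modeEnergy e k (U t) := by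
      intro k t
      have := hcC (inner ℝ (e k) (U t).1, inner ℝ (e k) (U t).2.1, inner ℝ (e k) (U t).2.2)
      rwa [energy_coef] at this
    refine le_trans ?_ (h2.trans ?_)
    · rw [mul_assoc, ← intervalIntegral.integral_const_mul]
      refine mul_le_mul_of_nonneg_left ?_ hs
      refine intervalIntegral.integral_mono_on hT.le ?_ ?_ fun t _ => ?_
      · have := fun k => (continuous_modeEnergy e k).comp hUc
        simp only [Function.comp_def] at this
        exact Continuous.intervalIntegrable (by fun_prop) _ _
      · exact Continuous.intervalIntegrable (by fun_prop) _ _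
      · simp only [← Finset.mul_sum]
        rw [mul_left_comm]
        refine mul_le_mul_of_nonneg_left ?_ (by positivity)
        rw [Finset.mul_sum]
        exact Finset.sum_le_sum fun k _ => (hyE k t).1
    · refine intervalIntegral.integral_mono_on hT.le ?_ ?_ fun t ht => ?_
      · exact Continuous.intervalIntegrable (by fun_prop) _ _
      · have := continuous_energy.comp hUc
        simp only [Function.comp_def] at this
        exact Continuous.intervalIntegrable (by fun_prop) _ _
      · simp only [← Finset.mul_sum]
        rw [mul_assoc]
        refine mul_le_mul_of_nonneg_left ?_ (by positivity)
        have e1 : ∑ k ∈ S, ∑ j, (t ^ 2 * ‖-(r j + r j ^ 2) * (inner ℝ (e k) (n t) : ℝ)‖ ^ 2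
            + ‖y k j t‖ ^ 2)
            = t ^ 2 * (M * ∑ k ∈ S, inner ℝ (e k) (n t) ^ 2) + ∑ k ∈ S, ∑ j, ‖y k j t‖ ^ 2 := by
          simp only [Finset.sum_add_distrib]
          congr 1
          rw [Finset.mul_sum, Finset.mul_sum]
          refine Finset.sum_congr rfl fun k _ => ?_
          rw [hM, Finset.sum_mul, Finset.mul_sum]
          refine Finset.sum_congr rfl fun j _ => ?_
          rw [norm_mul, mul_pow, Complex.norm_real, Real.norm_eq_abs, sq_abs]
        rw [e1]
        have e2 : ∑ k ∈ S, inner ℝ (e k) (n t) ^ 2 ≤ K * energy (U t) :=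
          (sum_coef_sq_le e S (n t)).trans (hnU t ht)
        have e3 : ∑ k ∈ S, ∑ j, ‖y k j t‖ ^ 2 ≤ C * energy (U t) := by
          refine (Finset.sum_le_sum fun k _ => (hyE k t).2).trans ?_
          rw [← Finset.mul_sum]
          exact mul_le_mul_of_nonneg_left (sum_modeEnergy_le e S (U t)) hC.le
        have e4 : t ^ 2 * (M * ∑ k ∈ S, inner ℝ (e k) (n t) ^ 2)
            ≤ t ^ 2 * (M * (K * energy (U t))) := by gcongr
        nlinarith
  have hall : ∀ (s : ℝ), 0 ≤ s →
      s * c * ∫ t in (0 : ℝ)..T, Real.exp (s * t ^ 2) * t ^ 2 * energy (U t)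
        ≤ ∫ t in (0 : ℝ)..T, Real.exp (s * t ^ 2) * ((M * K) * t ^ 2 + C) * energy (U t) := by
    intro s hs
    refine le_of_tendsto ((tendsto_integral_sum_modeEnergy (e := e) (T := T) (U := U)
      (w := fun t => Real.exp (s * t ^ 2) * t ^ 2) (by fun_prop) hUc).const_mul (s * c)) ?_
    exact Eventually.of_forall fun S => hfin s hs S
  have hEc : Continuous fun t => energy (U t) := continuous_energy.comp hUc
  have hzero := eq_zero_of_weighted_integral_nonpos (p := fun t => energy (U t))
    (K := c⁻¹ * (M * K)) (C := c⁻¹ * C) hT (by positivity) (by positivity) hEc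
    (fun t => energy_nonneg _) (fun s hs => ?_)
  · have h0 : energy (U 0) = 0 := by
      have hlim : Tendsto (fun t => energy (U t)) (𝓝[>] 0) (𝓝 (energy (U 0))) :=
        (hEc.tendsto 0).mono_left nhdsWithin_le_nhds
      refine tendsto_nhds_unique hlim (tendsto_const_nhds.congr' ?_)
      filter_upwards [Ioc_mem_nhdsGT hT] with t ht
      exact (hzero t ht).symm
    have h1 := norm_sq_le_energy (U 0)
    rw [h0] at h1
    exact norm_eq_zero.1 (pow_eq_zero_iff (two_ne_zero) |>.1 (le_antisymm h1 (sq_nonneg _)))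
  · have h1 := hall s hs
    rw [← intervalIntegral.integral_const_mul, ← sub_nonpos, ← intervalIntegral.integral_sub
      (Continuous.intervalIntegrable (by fun_prop) _ _)
      (Continuous.intervalIntegrable (by fun_prop) _ _)] at h1
    have h2 : ∀ t, Real.exp (s * t ^ 2) * (((s - c⁻¹ * (M * K)) * t ^ 2 - c⁻¹ * C) * energy (U t))
        = c⁻¹ * (s * c * (Real.exp (s * t ^ 2) * t ^ 2 * energy (U t))
          - Real.exp (s * t ^ 2) * ((M * K) * t ^ 2 + C) * energy (U t)) := by
      intro t
      field_simp
      ring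
    simp only [h2]
    rw [intervalIntegral.integral_const_mul]
    exact mul_nonpos_of_nonneg_of_nonpos (by positivity) h1

end Carleman

/-! ### Global solutions of ordinary differential equations with an a priori bound -/

section ODE

variable {E : Type*} [NormedAddCommGroup E] [NormedSpace ℝ E]

/-- The radial retraction onto the ball of radius `R`. -/
def radialRetraction (R : ℝ) (z : E) : E := (R / max R ‖z‖) • z

theorem radialRetraction_of_norm_le {R : ℝ} (hR : 0 < R) {z : E} (hz : ‖z‖ ≤ R) :
    radialRetraction R z = z := by
  rw [radialRetraction, max_eq_left hz, div_self hR.ne', one_smul]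

theorem norm_radialRetraction_le {R : ℝ} (hR : 0 < R) (z : E) : ‖radialRetraction R z‖ ≤ R := by
  have hm : 0 < max R ‖z‖ := lt_max_of_lt_left hR
  rw [radialRetraction, norm_smul, Real.norm_of_nonneg (by positivity), div_mul_eq_mul_div,
    div_le_iff₀ hm]
  exact mul_le_mul_of_nonneg_left (le_max_right _ _) hR.le

theorem lipschitzWith_radialRetraction {R : ℝ} (hR : 0 < R) :
    LipschitzWith 2 (radialRetraction R : E → E) := by
  refine LipschitzWith.of_dist_le_mul fun z w => ?_
  rw [dist_eq_norm, dist_eq_norm]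
  set a := max R ‖z‖ with ha
  set b := max R ‖w‖ with hb
  have ha0 : 0 < a := lt_max_of_lt_left hR
  have hb0 : 0 < b := lt_max_of_lt_left hR
  have hab : |b - a| ≤ ‖z - w‖ := by
    have h1 : |b - a| ≤ |‖w‖ - ‖z‖| := by
      rw [ha, hb, max_comm R, max_comm R]
      exact abs_max_sub_max_le_abs _ _ _
    rw [norm_sub_rev]
    exact h1.trans (abs_norm_sub_norm_le _ _)
  have hdec : radialRetraction R z - radialRetraction R w
      = (R / a) • (z - w) + (R * (b - a) / (a * b)) • w := by
    have : R * (b - a) / (a * b) = R / a - R / b := by field_simp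
    rw [this, sub_smul, smul_sub]
    simp only [radialRetraction, ← ha, ← hb]
    abel
  have h1 : ‖(R / a) • (z - w)‖ ≤ ‖z - w‖ := by
    rw [norm_smul, Real.norm_of_nonneg (by positivity)]
    exact mul_le_of_le_one_left (norm_nonneg _) ((div_le_one ha0).2 (le_max_left _ _))
  have h2 : ‖(R * (b - a) / (a * b)) • w‖ ≤ ‖z - w‖ := by
    rw [norm_smul, norm_div, norm_mul, Real.norm_of_nonneg hR.le,
      Real.norm_of_nonneg (mul_pos ha0 hb0).le, Real.norm_eq_abs, div_mul_eq_mul_div,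
      div_le_iff₀ (mul_pos ha0 hb0)]
    have h3 : R * ‖w‖ ≤ a * b :=
      mul_le_mul (le_max_left _ _) (le_max_right _ _) (norm_nonneg _) ha0.le
    calc R * |b - a| * ‖w‖ = |b - a| * (R * ‖w‖) := by ring
      _ ≤ ‖z - w‖ * (a * b) := mul_le_mul hab h3 (by positivity) (norm_nonneg _)
  rw [hdec]
  refine (norm_add_le _ _).trans ?_
  simp only [NNReal.coe_ofNat]
  linarith

/-- If the vector field `G` is Lipschitz on balls and the solutions starting at `u₀` satisfy an a
priori bound up to time `T`, then there is a solution up to time `T`. The vector field is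
truncated outside a larger ball; the solution for the truncated field never leaves this ball. -/
theorem exists_solution_of_apriori [CompleteSpace E] {G : E → E} {u₀ : E} {T R : ℝ} (hT : 0 ≤ T)
    (hR : 0 ≤ R) (hG : ∀ r : ℝ, ∃ K, LipschitzOnWith K G (Metric.closedBall 0 r))
    (hap : ∀ τ ∈ Icc 0 T, ∀ U : ℝ → E, Continuous U → U 0 = u₀ →
      (∀ t ∈ Ioo 0 τ, HasDerivAt U (G (U t)) t) → ‖U τ‖ ≤ R) :
    ∃ U : ℝ → E, Continuous U ∧ U 0 = u₀ ∧ (∀ t ∈ Ioo 0 T, HasDerivAt U (G (U t)) t) ∧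
      (∀ t, U t = U (projIcc 0 T hT t)) ∧ ∀ t, ‖U t‖ ≤ R := by
  have hR1 : 0 < R + 1 := by linarith
  obtain ⟨K, hK⟩ := hG (R + 1)
  set G' : E → E := G ∘ radialRetraction (R + 1) with hG'
  have hmem : ∀ z : E, radialRetraction (R + 1) z ∈ Metric.closedBall (0 : E) (R + 1) := fun z => by
    rw [mem_closedBall_zero_iff]; exact norm_radialRetraction_le hR1 z
  have hlip : LipschitzWith (K * 2) G' := by
    rw [← lipschitzOnWith_univ]
    exact hK.comp (lipschitzOnWith_univ.2 (lipschitzWith_radialRetraction hR1)) fun z _ => hmem z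
  obtain ⟨L, hL⟩ : ∃ L : NNReal, ∀ z, ‖G' z‖ ≤ L := by
    refine ⟨K * (Real.toNNReal (R + 1)) + ‖G 0‖₊, fun z => ?_⟩
    have h := hK.dist_le_mul _ (hmem z) 0 (by simp [hR1.le])
    rw [dist_eq_norm, dist_zero_right] at h
    have h2 : ‖G' z‖ ≤ ‖G (radialRetraction (R + 1) z) - G 0‖ + ‖G 0‖ := by
      simpa [hG'] using norm_add_le (G (radialRetraction (R + 1) z) - G 0) (G 0)
    push_cast
    rw [Real.coe_toNNReal _ hR1.le]
    have h3 := mul_le_mul_of_nonneg_left (norm_radialRetraction_le hR1 z) K.coe_nonneg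
    linarith
  have hPL : IsPicardLindelof (fun _ => G') (⟨0, left_mem_Icc.2 hT⟩ : Icc (0 : ℝ) T) u₀
      (L * Real.toNNReal T) 0 L (K * 2) := by
    refine ⟨fun _ _ => hlip.lipschitzOnWith, fun _ _ => continuousOn_const, fun _ _ z _ => hL z, ?_⟩
    simp [hT]
  obtain ⟨α, hα0, hα⟩ := hPL.exists_eq_forall_mem_Icc_hasDerivWithinAt₀
  have hαc : ContinuousOn α (Icc 0 T) := fun t ht => (hα t ht).continuousWithinAt
  set U : ℝ → E := fun t => α (projIcc 0 T hT t) with hU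
  have hUc : Continuous U := hαc.domRestrict.comp continuous_projIcc
  have hUα : ∀ t ∈ Icc 0 T, U t = α t := fun t ht => by simp only [hU, projIcc_of_mem hT ht]
  have hU0 : U 0 = u₀ := by rw [hUα 0 (left_mem_Icc.2 hT)]; exact hα0
  have hUd' : ∀ t ∈ Ioo 0 T, HasDerivAt U (G' (U t)) t := by
    intro t ht
    have h1 := (hα t (Ioo_subset_Icc_self ht)).hasDerivAt (Icc_mem_nhds ht.1 ht.2)
    rw [hUα t (Ioo_subset_Icc_self ht)]
    refine h1.congr_of_eventuallyEq ?_
    filter_upwards [Icc_mem_nhds ht.1 ht.2] with s hs using hUα s hs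
  have hUG : ∀ t, ‖U t‖ ≤ R + 1 → G' (U t) = G (U t) := fun t ht => by
    simp only [hG', Function.comp_apply, radialRetraction_of_norm_le hR1 ht]
  -- the first time at which the solution would reach the boundary of the larger ball
  have hlt : ∀ t ∈ Icc 0 T, ‖U t‖ < R + 1 := by
    by_contra! hcon
    obtain ⟨t₁, ht₁, hbig⟩ := hcon
    have hcpt : IsCompact (Icc 0 T ∩ {t | R + 1 ≤ ‖U t‖}) :=
      isCompact_Icc.inter_right (isClosed_le continuous_const hUc.norm)
    obtain ⟨τ, hτ, hleast⟩ := hcpt.exists_isLeast ⟨t₁, ht₁, hbig⟩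
    have hsol : ∀ t ∈ Ioo 0 τ, HasDerivAt U (G (U t)) t := by
      intro t ht
      have htT : t ∈ Ioo 0 T := ⟨ht.1, ht.2.trans_le hτ.1.2⟩
      rw [← hUG t]
      · exact hUd' t htT
      · by_contra! h
        exact absurd (hleast ⟨Ioo_subset_Icc_self htT, h.le⟩) (not_le.2 ht.2)
    have h1 := hap τ hτ.1 U hUc hU0 hsol
    have h2 : R + 1 ≤ ‖U τ‖ := hτ.2
    linarith
  have hUd : ∀ t ∈ Ioo 0 T, HasDerivAt U (G (U t)) t := fun t ht => by
    rw [← hUG t (hlt t (Ioo_subset_Icc_self ht)).le]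
    exact hUd' t ht
  have hproj : ∀ t, U t = U (projIcc 0 T hT t) := fun t => by
    simp only [hU, projIcc_val]
  refine ⟨U, hUc, hU0, hUd, hproj, fun t => ?_⟩
  rw [hproj t]
  have hmemt := (projIcc 0 T hT t).2
  exact hap _ hmemt U hUc hU0 fun s hs => hUd s ⟨hs.1, hs.2.trans_le hmemt.2⟩

end ODE

/-! ### The nonlinear system: continuous dependence, uniqueness, existence -/

section Nonlinear

variable {H : Type*} [NormedAddCommGroup H] [InnerProductSpace ℝ H]

/-- The nonlinear term `(β + ⟪B x, x⟫) x`; for `B = A ^ (-1/2)` and `x = A ^ (1/2) u` it is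
`(β + ‖u‖₁²) A ^ (1/2) u`. -/
def nonlin (B : H →L[ℝ] H) (β : ℝ) (x : H) : H := (β + inner ℝ (B x) x) • x

theorem continuous_nonlin (B : H →L[ℝ] H) (β : ℝ) : Continuous (nonlin B β) := by
  unfold nonlin; fun_prop

/-- A Lipschitz constant of `nonlin B β` on the ball of radius `R`. -/
def nonlinLip (B : H →L[ℝ] H) (β R : ℝ) : ℝ := |β| + 3 * ‖B‖ * R ^ 2

theorem nonlinLip_nonneg (B : H →L[ℝ] H) (β R : ℝ) : 0 ≤ nonlinLip B β R := by
  unfold nonlinLip; positivity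

theorem norm_nonlin_sub_le (B : H →L[ℝ] H) (β : ℝ) {R : ℝ} {x y : H} (hx : ‖x‖ ≤ R)
    (hy : ‖y‖ ≤ R) : ‖nonlin B β x - nonlin B β y‖ ≤ nonlinLip B β R * ‖x - y‖ := by
  have hR : 0 ≤ R := (norm_nonneg x).trans hx
  have hdec : nonlin B β x - nonlin B β y
      = (β + inner ℝ (B x) x) • (x - y)
        + (inner ℝ (B (x - y)) x + inner ℝ (B y) (x - y)) • y := by
    have : inner ℝ (B (x - y)) x + inner ℝ (B y) (x - y) = inner ℝ (B x) x - inner ℝ (B y) y := by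
      rw [map_sub, inner_sub_left, inner_sub_right]; ring
    rw [this, nonlin, nonlin, smul_sub, sub_smul, add_smul, add_smul, add_smul]
    abel
  have hB : ∀ u w : H, |inner ℝ (B u) w| ≤ ‖B‖ * ‖u‖ * ‖w‖ := fun u w =>
    (abs_real_inner_le_norm _ _).trans
      (mul_le_mul_of_nonneg_right (B.le_opNorm u) (norm_nonneg _))
  have h1 : |β + inner ℝ (B x) x| ≤ |β| + ‖B‖ * R ^ 2 := by
    refine (abs_add_le _ _).trans (add_le_add_right ((hB x x).trans ?_) _)
    calc ‖B‖ * ‖x‖ * ‖x‖ ≤ ‖B‖ * R * R := by gcongr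
      _ = _ := by ring
  have h2 : |inner ℝ (B (x - y)) x + inner ℝ (B y) (x - y)| ≤ 2 * ‖B‖ * R * ‖x - y‖ := by
    refine (abs_add_le _ _).trans ((add_le_add (hB _ _) (hB _ _)).trans ?_)
    calc ‖B‖ * ‖x - y‖ * ‖x‖ + ‖B‖ * ‖y‖ * ‖x - y‖
        ≤ ‖B‖ * ‖x - y‖ * R + ‖B‖ * R * ‖x - y‖ := by gcongr
      _ = _ := by ring
  rw [hdec]
  refine (norm_add_le _ _).trans ?_
  rw [norm_smul, norm_smul, Real.norm_eq_abs, Real.norm_eq_abs]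
  calc |β + inner ℝ (B x) x| * ‖x - y‖
        + |inner ℝ (B (x - y)) x + inner ℝ (B y) (x - y)| * ‖y‖
      ≤ (|β| + ‖B‖ * R ^ 2) * ‖x - y‖ + (2 * ‖B‖ * R * ‖x - y‖) * R := by gcongr
    _ = _ := by unfold nonlinLip; ring

variable {ι : Type*}

/-- `U = (x, v, θ)` is a solution on `(0, T)` of the nonlinear system, written in modes. -/
def IsSol (e : HilbertBasis ι ℝ H) (μ : ι → ℝ) (B : H →L[ℝ] H) (β : ℝ) (f g : H) (T : ℝ)
    (U : ℝ → H × H × H) : Prop :=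
  ModeSol e μ (fun t => f - nonlin B β (U t).1) (fun _ => g) T U

namespace IsSol

variable {e : HilbertBasis ι ℝ H} {μ : ι → ℝ} {B : H →L[ℝ] H} {β : ℝ} {f g f' g' : H} {T : ℝ}
  {U V : ℝ → H × H × H}

/-- Continuous dependence on the initial data and on `f` and `g`, for bounded solutions. -/
theorem energy_sub_le (hU : IsSol e μ B β f g T U) (hV : IsSol e μ B β f' g' T V)
    (hμ : ∀ k, 0 ≤ μ k) {R : ℝ} (hUR : ∀ t ∈ Icc 0 T, ‖U t‖ ≤ R) (hVR : ∀ t ∈ Icc 0 T, ‖V t‖ ≤ R)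
    {t : ℝ} (ht : t ∈ Icc 0 T) :
    energy (U t - V t) ≤ (energy (U 0 - V 0) + (‖f - f'‖ ^ 2 + ‖g - g'‖ ^ 2) * t)
      * Real.exp ((nonlinLip B β R + 1) * t) := by
  refine (hU.sub hV).energy_le hμ (a := nonlinLip B β R + 1) (d := ‖f - f'‖ ^ 2 + ‖g - g'‖ ^ 2)
    (by linarith [nonlinLip_nonneg B β R]) (by positivity) (fun t ht => ?_) ht
  have hK := nonlinLip_nonneg B β R
  have ht' := Ioo_subset_Icc_self ht
  have hN := norm_nonlin_sub_le B β ((norm_fst_le _).trans (hUR t ht'))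
    ((norm_fst_le _).trans (hVR t ht'))
  have hn : ‖((fun t => f - nonlin B β (U t).1) - fun t => f' - nonlin B β (V t).1) t‖
      ≤ ‖f - f'‖ + nonlinLip B β R * ‖(U t - V t).1‖ := by
    have : ((fun t => f - nonlin B β (U t).1) - fun t => f' - nonlin B β (V t).1) t
        = (f - f') - (nonlin B β (U t).1 - nonlin B β (V t).1) := by
      simp only [Pi.sub_apply]; abel
    rw [this]
    exact (norm_sub_le _ _).trans (add_le_add_right hN _)
  simp only [Pi.sub_apply] at hn ⊢
  unfold energy
  set x := ‖(U t - V t).1‖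
  set v := ‖(U t - V t).2.1‖ with hv
  set θ := ‖(U t - V t).2.2‖
  have hv0 : 0 ≤ v := norm_nonneg _
  have h1 := mul_le_mul_of_nonneg_right hn hv0
  nlinarith [sq_nonneg (‖f - f'‖ - v), sq_nonneg (‖g - g'‖ - θ), mul_nonneg hK (sq_nonneg (x - v)),
    mul_nonneg hK (sq_nonneg θ), sq_nonneg x]

theorem mono (hU : IsSol e μ B β f g T U) {T' : ℝ} (h : T' ≤ T) : IsSol e μ B β f g T' U :=
  ModeSol.mono hU h

theorem eq_of_eq_zero (hU : IsSol e μ B β f g T U) (hV : IsSol e μ B β f g T V)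
    (hμ : ∀ k, 0 ≤ μ k) (h0 : U 0 = V 0) {t : ℝ} (ht : t ∈ Icc 0 T) : U t = V t := by
  obtain ⟨R₁, hR₁⟩ := isCompact_Icc.exists_bound_of_continuousOn (s := Icc 0 T) hU.cont.continuousOn
  obtain ⟨R₂, hR₂⟩ := isCompact_Icc.exists_bound_of_continuousOn (s := Icc 0 T) hV.cont.continuousOn
  have h := hU.energy_sub_le hV hμ (R := max R₁ R₂) (fun t ht => (hR₁ t ht).trans (le_max_left _ _))
    (fun t ht => (hR₂ t ht).trans (le_max_right _ _)) ht
  have h1 := norm_sq_le_energy (U t - V t)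
  have h2 : energy (U t - V t) ≤ 0 := by simpa [h0, energy] using h
  have h3 : ‖U t - V t‖ = 0 := by
    have := sq_nonneg ‖U t - V t‖
    exact pow_eq_zero_iff two_ne_zero |>.1 (by linarith)
  exact sub_eq_zero.1 (norm_eq_zero.1 h3)

/-- Backward uniqueness for the nonlinear system. -/
theorem eq_zero_of_eq_end [Countable ι] (hU : IsSol e μ B β f g T U) (hV : IsSol e μ B β f g T V)
    (hT : 0 < T) (hUV : U T = V T) : U 0 = V 0 := by
  obtain ⟨R₁, hR₁⟩ := isCompact_Icc.exists_bound_of_continuousOn (s := Icc 0 T) hU.cont.continuousOn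
  obtain ⟨R₂, hR₂⟩ := isCompact_Icc.exists_bound_of_continuousOn (s := Icc 0 T) hV.cont.continuousOn
  set n : ℝ → H := (fun t => f - nonlin B β (U t).1) - fun t => f - nonlin B β (V t).1 with hn
  have hW : ModeSol e μ n 0 T (U - V) := by
    have h := hU.sub hV
    have h0 : ((fun _ => g) - fun _ => g : ℝ → H) = 0 := sub_self _
    rwa [h0] at h
  have hnc : Continuous n :=
    (continuous_const.sub ((continuous_nonlin B β).comp hU.cont.fst)).sub
      (continuous_const.sub ((continuous_nonlin B β).comp hV.cont.fst))
  have h := hW.eq_zero_of_eq_zero_end hT hnc (K := nonlinLip B β (max R₁ R₂) ^ 2) (sq_nonneg _)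
    (fun t ht => ?_) (by simp [hUV])
  · exact sub_eq_zero.1 h
  · have hN := norm_nonlin_sub_le B β
      (((norm_fst_le _).trans (hR₁ t ht)).trans (le_max_left R₁ R₂))
      (((norm_fst_le _).trans (hR₂ t ht)).trans (le_max_right R₁ R₂))
    have hnt : n t = -(nonlin B β (U t).1 - nonlin B β (V t).1) := by
      simp only [hn, Pi.sub_apply]; abel
    rw [hnt, norm_neg]
    calc ‖nonlin B β (U t).1 - nonlin B β (V t).1‖ ^ 2
        ≤ (nonlinLip B β (max R₁ R₂) * ‖(U t).1 - (V t).1‖) ^ 2 :=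
          pow_le_pow_left₀ (norm_nonneg _) hN 2
      _ = nonlinLip B β (max R₁ R₂) ^ 2 * ‖(U t).1 - (V t).1‖ ^ 2 := mul_pow _ _ _
      _ ≤ _ := by
        refine mul_le_mul_of_nonneg_left ?_ (sq_nonneg _)
        simp only [energy, Pi.sub_apply, Prod.fst_sub]
        nlinarith [sq_nonneg ‖(U t - V t).2.1‖, sq_nonneg ‖(U t - V t).2.2‖]

end IsSol

end Nonlinear

/-! ### Galerkin approximations -/

section Galerkin

variable {H : Type*} [NormedAddCommGroup H] [InnerProductSpace ℝ H]

/-- The vector field of the system truncated to finitely many modes: `P` is the projection onto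
these modes and `D` is `A ^ (1/2) P`. -/
def galerkinField (D P B : H →L[ℝ] H) (β : ℝ) (f g : H) (z : H × H × H) : H × H × H :=
  (D z.2.1, P f + D (z.2.2 - z.1) - P (nonlin B β z.1), P g - D (z.2.2 + z.2.1))

theorem exists_lipschitzOnWith_galerkinField (D P B : H →L[ℝ] H) (β : ℝ) (f g : H) (r : ℝ) :
    ∃ K, LipschitzOnWith K (galerkinField D P B β f g) (Metric.closedBall 0 r) := by
  refine ⟨Real.toNNReal (2 * ‖D‖ + ‖P‖ * nonlinLip B β r), LipschitzOnWith.of_dist_le_mul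
    fun z hz w hw => ?_⟩
  rw [mem_closedBall_zero_iff] at hz hw
  have hL := nonlinLip_nonneg B β r
  rw [Real.coe_toNNReal _ (by positivity), dist_eq_norm, dist_eq_norm]
  have h1 : ‖z.1 - w.1‖ ≤ ‖z - w‖ := norm_fst_le (z - w)
  have h2 : ‖z.2.1 - w.2.1‖ ≤ ‖z - w‖ := (norm_fst_le (z - w).2).trans (norm_snd_le (z - w))
  have h3 : ‖z.2.2 - w.2.2‖ ≤ ‖z - w‖ := (norm_snd_le (z - w).2).trans (norm_snd_le (z - w))
  have hN := norm_nonlin_sub_le B β ((norm_fst_le z).trans hz) ((norm_fst_le w).trans hw)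
  have hD : ∀ x y : H, ‖x‖ ≤ ‖z - w‖ → ‖y‖ ≤ ‖z - w‖ → ‖D (x - y)‖ ≤ 2 * ‖D‖ * ‖z - w‖ := by
    intro x y hx hy
    calc ‖D (x - y)‖ ≤ ‖D‖ * ‖x - y‖ := D.le_opNorm _
      _ ≤ ‖D‖ * (‖z - w‖ + ‖z - w‖) := by
        gcongr
        exact (norm_sub_le _ _).trans (add_le_add hx hy)
      _ = _ := by ring
  have hPN : ‖P (nonlin B β z.1 - nonlin B β w.1)‖ ≤ ‖P‖ * nonlinLip B β r * ‖z - w‖ := by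
    calc _ ≤ ‖P‖ * ‖nonlin B β z.1 - nonlin B β w.1‖ := P.le_opNorm _
      _ ≤ ‖P‖ * (nonlinLip B β r * ‖z - w‖) := by
        gcongr
        exact hN.trans (mul_le_mul_of_nonneg_left h1 hL)
      _ = _ := by ring
  have hP0 : 0 ≤ ‖P‖ * nonlinLip B β r * ‖z - w‖ := by positivity
  have e1 : (galerkinField D P B β f g z - galerkinField D P B β f g w).1
      = D ((z.2.1 - w.2.1) - 0) := by simp [galerkinField]
  have e2 : (galerkinField D P B β f g z - galerkinField D P B β f g w).2.1
      = D ((z.2.2 - w.2.2) - (z.1 - w.1)) - P (nonlin B β z.1 - nonlin B β w.1) := by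
    simp only [galerkinField, Prod.snd_sub, Prod.fst_sub, map_sub]; abel
  have e3 : (galerkinField D P B β f g z - galerkinField D P B β f g w).2.2
      = D (-(z.2.2 - w.2.2) - (z.2.1 - w.2.1)) := by
    simp only [galerkinField, Prod.snd_sub, map_sub, map_add, map_neg]; abel
  rw [Prod.norm_def, Prod.norm_def, e1, e2, e3, add_mul]
  refine max_le ?_ (max_le ?_ ?_)
  · linarith [hD _ 0 h2 (by simp)]
  · exact (norm_sub_le _ _).trans (add_le_add (hD _ _ h3 h1) hPN)
  · linarith [hD (-(z.2.2 - w.2.2)) _ (by rw [norm_neg]; exact h3) h2]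

/-- The energy of the nonlinear system (without the potential of `f`). -/
def nonlinEnergy (B : H →L[ℝ] H) (β : ℝ) (z : H × H × H) : ℝ :=
  energy z / 2 + (β + inner ℝ (B z.1) z.1) ^ 2 / 4

/-- The energy of a Galerkin approximation grows at most exponentially, at a rate that does not
depend on the modes that are kept. -/
theorem nonlinEnergy_le {D P B : H →L[ℝ] H} {β : ℝ} {f g : H}
    (hDs : ∀ x y, inner ℝ (D x) y = inner ℝ x (D y)) (hD0 : ∀ x, 0 ≤ inner ℝ (D x) x)
    (hPs : ∀ x y, inner ℝ (P x) y = inner ℝ x (P y)) (hP1 : ∀ x, ‖P x‖ ≤ ‖x‖)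
    (hBs : ∀ x y, inner ℝ (B x) y = inner ℝ x (B y)) (hBD : ∀ x, B (D x) = P x)
    {τ : ℝ} (hτ : 0 ≤ τ) {U : ℝ → H × H × H} (hU : Continuous U)
    (hd : ∀ t ∈ Ioo 0 τ, HasDerivAt U (galerkinField D P B β f g (U t)) t) :
    nonlinEnergy B β (U τ)
      ≤ (nonlinEnergy B β (U 0) + (‖f‖ ^ 2 + ‖g‖ ^ 2) / 2) * Real.exp τ := by
  set C := (‖f‖ ^ 2 + ‖g‖ ^ 2) / 2 with hC
  have hC0 : 0 ≤ C := by positivity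
  set Y' : ℝ → ℝ := fun t => inner ℝ (P f) (U t).2.1 + inner ℝ (P g) (U t).2.2
    - inner ℝ (D (U t).2.2) (U t).2.2 with hY'
  have hYd : ∀ t ∈ Ioo 0 τ, HasDerivAt (fun t => nonlinEnergy B β (U t)) (Y' t) t := by
    intro t ht
    have hx := (hasFDerivAt_fst.comp_hasDerivAt t (hd t ht))
    have hv := (hasFDerivAt_fst.comp_hasDerivAt t (hasFDerivAt_snd.comp_hasDerivAt t (hd t ht)))
    have hθ := (hasFDerivAt_snd.comp_hasDerivAt t (hasFDerivAt_snd.comp_hasDerivAt t (hd t ht)))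
    have hBx := B.hasFDerivAt.comp_hasDerivAt t hx
    have h := (((hx.norm_sq.add hv.norm_sq).add hθ.norm_sq).div_const 2).add
      ((((hBx.inner ℝ hx).const_add β).pow 2).div_const 4)
    refine h.congr_deriv ?_
    simp only [galerkinField, Function.comp_apply, ContinuousLinearMap.coe_fst',
      ContinuousLinearMap.coe_snd', hY', nonlin]
    have c1 : inner ℝ (B (U t).1) (D (U t).2.1) = inner ℝ (U t).1 (P (U t).2.1) := by
      rw [hBs, hBD]
    have c2 : inner ℝ (B (D (U t).2.1)) (U t).1 = inner ℝ (U t).1 (P (U t).2.1) := by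
      rw [hBD, real_inner_comm]
    have c3 : inner ℝ (U t).2.1 (P (U t).1) = inner ℝ (U t).1 (P (U t).2.1) := by
      rw [← hPs, real_inner_comm]
    have c4 : inner ℝ (U t).2.1 (D (U t).1) = inner ℝ (U t).1 (D (U t).2.1) := by
      rw [← hDs, real_inner_comm]
    have c5 : inner ℝ (U t).2.2 (D (U t).2.1) = inner ℝ (U t).2.1 (D (U t).2.2) := by
      rw [← hDs, real_inner_comm]
    simp only [map_sub, map_add, map_smul, inner_add_right, inner_sub_right,
      real_inner_smul_right, c1, c2, c3, c4, c5]
    rw [real_inner_comm (U t).2.1 (P f), real_inner_comm (U t).2.2 (P g),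
      real_inner_comm (U t).2.2 (D (U t).2.2)]
    push_cast
    ring
  have hYle : ∀ t, Y' t ≤ C + nonlinEnergy B β (U t) := by
    intro t
    have h1 : inner ℝ (P f) (U t).2.1 ≤ ‖f‖ * ‖(U t).2.1‖ :=
      (real_inner_le_norm _ _).trans (mul_le_mul_of_nonneg_right (hP1 f) (norm_nonneg _))
    have h2 : inner ℝ (P g) (U t).2.2 ≤ ‖g‖ * ‖(U t).2.2‖ :=
      (real_inner_le_norm _ _).trans (mul_le_mul_of_nonneg_right (hP1 g) (norm_nonneg _))
    have h3 := hD0 (U t).2.2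
    simp only [hY', hC, nonlinEnergy, energy]
    nlinarith [sq_nonneg (‖f‖ - ‖(U t).2.1‖), sq_nonneg (‖g‖ - ‖(U t).2.2‖),
      sq_nonneg ‖(U t).1‖, sq_nonneg (β + inner ℝ (B (U t).1) (U t).1)]
  have hYc : Continuous fun t => nonlinEnergy B β (U t) := by
    have := continuous_energy.comp hU
    simp only [Function.comp_def] at this
    unfold nonlinEnergy
    fun_prop
  have hanti : AntitoneOn (fun t => Real.exp (-t) * (nonlinEnergy B β (U t) + C)) (Icc 0 τ) := by
    refine antitoneOn_of_hasDerivWithinAt_nonpos (convex_Icc 0 τ)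
      (f' := fun t => Real.exp (-t) * (Y' t - (nonlinEnergy B β (U t) + C)))
      (Continuous.continuousOn (by fun_prop)) ?_ ?_
    · rw [interior_Icc]
      intro t ht
      have h := (hasDerivAt_id t).neg.exp.mul ((hYd t ht).add_const C)
      exact (h.congr_deriv (by simp; ring)).hasDerivWithinAt
    · intro t _
      exact mul_nonpos_of_nonneg_of_nonpos (Real.exp_pos _).le (by linarith [hYle t])
  have h := hanti (left_mem_Icc.2 hτ) (right_mem_Icc.2 hτ) hτ
  simp only [neg_zero, Real.exp_zero, one_mul] at h
  have h2 : nonlinEnergy B β (U τ) + C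
      = Real.exp (-τ) * (nonlinEnergy B β (U τ) + C) * Real.exp τ := by
    rw [mul_right_comm, ← Real.exp_add]
    simp
  have h3 := mul_le_mul_of_nonneg_right h (Real.exp_pos τ).le
  linarith

variable {ι : Type*} {e : HilbertBasis ι ℝ H} {μ : ι → ℝ}

open Classical in
/-- The indicator function of a finite set of modes: the entries of the projection onto them. -/
def modeIndicator (F : Finset ι) (k : ι) : ℝ := if k ∈ F then 1 else 0

theorem exists_projection (e : HilbertBasis ι ℝ H) :
    ∃ P : Finset ι → H →L[ℝ] H, ∀ F, IsDiag e (modeIndicator F) (P F) := by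
  have h : ∀ F, ∃ P : H →L[ℝ] H, IsDiag e (modeIndicator F) P := fun F =>
    exists_isDiag e _ 1 fun k => by unfold modeIndicator; split_ifs <;> simp
  exact ⟨fun F => (h F).choose, fun F => (h F).choose_spec⟩

theorem norm_projection_le {F : Finset ι} {P : H →L[ℝ] H} (hP : IsDiag e (modeIndicator F) P)
    (x : H) : ‖P x‖ ≤ ‖x‖ := by
  have h := hP.norm_apply_le zero_le_one
    (fun k => by unfold modeIndicator; split_ifs <;> simp) x
  rwa [one_mul] at h

theorem tendsto_projection {P : Finset ι → H →L[ℝ] H}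
    (hP : ∀ F, IsDiag e (modeIndicator F) (P F)) (x : H) :
    Tendsto (fun F => P F x) atTop (𝓝 x) := by
  classical
  have h := e.hasSum_repr x
  refine Tendsto.congr (fun F => ?_) h
  refine ext_coef e fun k => ?_
  rw [hP F k, inner_sum]
  simp only [real_inner_smul_right, orthonormal_iff_ite.1 e.orthonormal, e.repr_apply_apply,
    modeIndicator]
  simp

/-- The Galerkin approximations exist, are bounded uniformly in the set of modes, and solve the
full system of modes exactly, for projected data: the system does not couple a mode that is kept
to one that is dropped, except through a scalar factor. -/
theorem exists_galerkin [CompleteSpace H] {B : H →L[ℝ] H} (hμ : ∀ k, 0 < μ k)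
    (hB : IsDiag e (fun k => (μ k)⁻¹) B) (β : ℝ) (f g : H) {P : Finset ι → H →L[ℝ] H}
    (hP : ∀ F, IsDiag e (modeIndicator F) (P F)) {T : ℝ} (hT : 0 ≤ T) (u₀ : H × H × H) :
    ∃ R, ∀ F, ∃ U : ℝ → H × H × H, IsSol e μ B β (P F f) (P F g) T U ∧
      U 0 = (P F u₀.1, P F u₀.2.1, P F u₀.2.2) ∧ (∀ t, U t = U (projIcc 0 T hT t)) ∧
      ∀ t, ‖U t‖ ≤ R := by
  set C := (‖f‖ ^ 2 + ‖g‖ ^ 2) / 2 with hC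
  set Y₀ := energy u₀ / 2 + (|β| + ‖B‖ * ‖u₀.1‖ ^ 2) ^ 2 / 4 with hY₀
  have hY₀0 : 0 ≤ Y₀ := by have := energy_nonneg u₀; positivity
  refine ⟨Real.sqrt (2 * ((Y₀ + C) * Real.exp T)), fun F => ?_⟩
  obtain ⟨D, hD⟩ : ∃ D : H →L[ℝ] H, IsDiag e (fun k => μ k * modeIndicator F k) D := by
    refine exists_isDiag e _ (∑ k ∈ F, μ k) fun k => ?_
    have h0 : 0 ≤ ∑ k ∈ F, μ k := Finset.sum_nonneg fun k _ => (hμ k).le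
    unfold modeIndicator
    split_ifs with hk
    · rw [mul_one, abs_of_pos (hμ k)]
      exact Finset.single_le_sum (f := μ) (fun k _ => (hμ k).le) hk
    · simpa using h0
  have hDk : ∀ k x, inner ℝ (e k) (D x) = μ k * modeIndicator F k * inner ℝ (e k) x := hD
  have hi0 : ∀ k, 0 ≤ modeIndicator F k := fun k => by unfold modeIndicator; split_ifs <;> simp
  have hD0 : ∀ x, 0 ≤ inner ℝ (D x) x := by
    intro x
    have h := e.hasSum_inner_mul_inner (D x) x
    refine h.nonneg fun k => ?_
    rw [real_inner_comm, hD k x, mul_assoc]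
    exact mul_nonneg (mul_nonneg (hμ k).le (hi0 k)) (mul_self_nonneg _)
  have hBD : ∀ x, B (D x) = P F x := fun x => ext_coef e fun k => by
    rw [hB k, hD k, hP F k, ← mul_assoc, ← mul_assoc, inv_mul_cancel₀ (hμ k).ne', one_mul]
  set w₀ : H × H × H := (P F u₀.1, P F u₀.2.1, P F u₀.2.2) with hw₀
  have hw₀Y : nonlinEnergy B β w₀ ≤ Y₀ := by
    have hP1 := norm_projection_le (hP F)
    have h1 : energy w₀ ≤ energy u₀ := by
      simp only [energy, hw₀]
      gcongr <;> exact hP1 _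
    have h2 : |β + inner ℝ (B w₀.1) w₀.1| ≤ |β| + ‖B‖ * ‖u₀.1‖ ^ 2 := by
      refine (abs_add_le _ _).trans (add_le_add_right ((abs_real_inner_le_norm _ _).trans ?_) _)
      calc ‖B (P F u₀.1)‖ * ‖P F u₀.1‖ ≤ (‖B‖ * ‖P F u₀.1‖) * ‖P F u₀.1‖ := by
            gcongr; exact B.le_opNorm _
        _ ≤ (‖B‖ * ‖u₀.1‖) * ‖u₀.1‖ := by gcongr <;> exact hP1 _
        _ = _ := by ring
    have h3 : (β + inner ℝ (B w₀.1) w₀.1) ^ 2 ≤ (|β| + ‖B‖ * ‖u₀.1‖ ^ 2) ^ 2 := by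
      rw [← sq_abs]
      exact pow_le_pow_left₀ (abs_nonneg _) h2 2
    unfold nonlinEnergy
    linarith
  obtain ⟨U, hUc, hU0, hUd, hproj, hUR⟩ := exists_solution_of_apriori (u₀ := w₀) hT
    (Real.sqrt_nonneg (2 * ((Y₀ + C) * Real.exp T)))
    (exists_lipschitzOnWith_galerkinField D (P F) B β f g) (by
      intro τ hτ U hUc hU0 hUd
      have h1 := nonlinEnergy_le hD.inner_comm hD0 (hP F).inner_comm (norm_projection_le (hP F))
        hB.inner_comm hBD hτ.1 hUc hUd
      rw [hU0, ← hC] at h1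
      apply Real.le_sqrt_of_sq_le
      have h2 := norm_sq_le_energy (U τ)
      have h3 : energy (U τ) / 2 ≤ nonlinEnergy B β (U τ) := by
        unfold nonlinEnergy
        linarith [sq_nonneg (β + inner ℝ (B (U τ).1) (U τ).1)]
      have h4 : (nonlinEnergy B β w₀ + C) * Real.exp τ ≤ (Y₀ + C) * Real.exp T := by
        have : 0 ≤ Y₀ + C := by positivity
        refine mul_le_mul (by linarith) (Real.exp_le_exp.2 hτ.2) (Real.exp_pos _).le this
      linarith)
  have hdx : ∀ t ∈ Ioo 0 T, HasDerivAt (fun s => (U s).1) (D (U t).2.1) t := fun t ht => by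
    have h := hasFDerivAt_fst.comp_hasDerivAt t (hUd t ht)
    exact h
  have hdv : ∀ t ∈ Ioo 0 T, HasDerivAt (fun s => (U s).2.1)
      (P F f + D ((U t).2.2 - (U t).1) - P F (nonlin B β (U t).1)) t := fun t ht => by
    have h := hasFDerivAt_fst.comp_hasDerivAt t (hasFDerivAt_snd.comp_hasDerivAt t (hUd t ht))
    exact h
  have hdθ : ∀ t ∈ Ioo 0 T, HasDerivAt (fun s => (U s).2.2)
      (P F g - D ((U t).2.2 + (U t).2.1)) t := fun t ht => by
    have h := hasFDerivAt_snd.comp_hasDerivAt t (hasFDerivAt_snd.comp_hasDerivAt t (hUd t ht))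
    exact h
  have hx : ∀ k, ∀ t ∈ Ioo 0 T, HasDerivAt (fun s => inner ℝ (e k) (U s).1)
      (inner ℝ (e k) (D (U t).2.1)) t := fun k t ht =>
    (innerSL ℝ (e k)).hasFDerivAt.comp_hasDerivAt t (hdx t ht)
  have hv : ∀ k, ∀ t ∈ Ioo 0 T, HasDerivAt (fun s => inner ℝ (e k) (U s).2.1)
      (inner ℝ (e k) (P F f + D ((U t).2.2 - (U t).1) - P F (nonlin B β (U t).1))) t :=
    fun k t ht => (innerSL ℝ (e k)).hasFDerivAt.comp_hasDerivAt t (hdv t ht)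
  have hθ : ∀ k, ∀ t ∈ Ioo 0 T, HasDerivAt (fun s => inner ℝ (e k) (U s).2.2)
      (inner ℝ (e k) (P F g - D ((U t).2.2 + (U t).2.1))) t := fun k t ht =>
    (innerSL ℝ (e k)).hasFDerivAt.comp_hasDerivAt t (hdθ t ht)
  -- the dropped modes vanish identically
  have hdrop : ∀ k, k ∉ F → ∀ t ∈ Icc 0 T, inner ℝ (e k) (U t).1 = 0 ∧
      inner ℝ (e k) (U t).2.1 = 0 ∧ inner ℝ (e k) (U t).2.2 = 0 := by
    intro k hk
    have hik : modeIndicator F k = 0 := by simp [modeIndicator, hk]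
    have hconst : ∀ φ : ℝ → ℝ, Continuous φ → φ 0 = 0 → (∀ t ∈ Ioo 0 T, HasDerivAt φ 0 t) →
        ∀ t ∈ Icc 0 T, φ t = 0 := by
      intro φ hφ hφ0 hφd t ht
      have h1 := antitoneOn_of_hasDerivWithinAt_nonpos (convex_Icc 0 T) (f' := 0)
        hφ.continuousOn (by rw [interior_Icc]; exact fun t ht => (hφd t ht).hasDerivWithinAt)
        (fun _ _ => le_rfl) (left_mem_Icc.2 hT) ht ht.1
      have h2 := monotoneOn_of_hasDerivWithinAt_nonneg (convex_Icc 0 T) (f' := 0)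
        hφ.continuousOn (by rw [interior_Icc]; exact fun t ht => (hφd t ht).hasDerivWithinAt)
        (fun _ _ => le_rfl) (left_mem_Icc.2 hT) ht ht.1
      rw [← hφ0]
      exact le_antisymm h1 h2
    intro t ht
    refine ⟨hconst _ (by fun_prop) ?_ (fun t ht => (hx k t ht).congr_deriv ?_) t ht,
      hconst _ (by fun_prop) ?_ (fun t ht => (hv k t ht).congr_deriv ?_) t ht,
      hconst _ (by fun_prop) ?_ (fun t ht => (hθ k t ht).congr_deriv ?_) t ht⟩
    · rw [hU0]; simp only [hw₀, (hP F) k, hik, zero_mul]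
    · rw [hDk k, hik]; ring
    · rw [hU0]; simp only [hw₀, (hP F) k, hik, zero_mul]
    · rw [inner_sub_right, inner_add_right, hDk k, (hP F) k, (hP F) k, hik]; ring
    · rw [hU0]; simp only [hw₀, (hP F) k, hik, zero_mul]
    · rw [inner_sub_right, hDk k, (hP F) k, hik]; ring
  refine ⟨U, ⟨hUc, fun k t ht => ?_, fun k t ht => ?_, fun k t ht => ?_⟩, hU0, hproj, hUR⟩
  · refine (hx k t ht).congr_deriv ?_
    rw [hDk k]
    by_cases hk : k ∈ F
    · simp [modeIndicator, hk]
    · rw [(hdrop k hk t (Ioo_subset_Icc_self ht)).2.1, mul_zero, mul_zero]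
  · refine (hv k t ht).congr_deriv ?_
    rw [inner_sub_right, inner_add_right, inner_sub_right, hDk k, (hP F) k (nonlin _ _ _),
      inner_sub_right]
    by_cases hk : k ∈ F
    · simp [modeIndicator, hk]; ring
    · obtain ⟨h1, -, h3⟩ := hdrop k hk t (Ioo_subset_Icc_self ht)
      simp [nonlin, real_inner_smul_right, h1, h3]
  · refine (hθ k t ht).congr_deriv ?_
    rw [inner_sub_right, hDk k, inner_add_right]
    by_cases hk : k ∈ F
    · simp [modeIndicator, hk]; ring
    · obtain ⟨-, h2, h3⟩ := hdrop k hk t (Ioo_subset_Icc_self ht)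
      simp [h2, h3]

end Galerkin

/-! ### Existence of solutions -/

section Existence

variable {H : Type*} [NormedAddCommGroup H] [InnerProductSpace ℝ H]
  {ι : Type*} {e : HilbertBasis ι ℝ H} {μ : ι → ℝ} {B : H →L[ℝ] H}

theorem tendstoUniformlyOn_of_dist_le {κ E : Type*} [NormedAddCommGroup E] {l : Filter κ}
    {V : κ → ℝ → E} {U : ℝ → E} (hV : TendstoUniformly V U l) {a : κ → ℝ → ℝ} {a' : ℝ → ℝ}
    {b : κ → ℝ} (hb : Tendsto b l (𝓝 0)) {C : ℝ} (hC : 0 ≤ C) {s : Set ℝ}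
    (h : ∀ i, ∀ t ∈ s, |a' t - a i t| ≤ C * ‖U t - V i t‖ + b i) :
    TendstoUniformlyOn a a' l s := by
  rw [Metric.tendstoUniformlyOn_iff]
  intro ε hε
  have hε' : 0 < ε / (2 * (C + 1)) := by positivity
  filter_upwards [Metric.tendstoUniformly_iff.1 hV _ hε',
    hb.eventually (gt_mem_nhds (half_pos hε))] with i hi hbi t ht
  rw [Real.dist_eq]
  refine (h i t ht).trans_lt ?_
  have h1 := hi t
  rw [dist_eq_norm, lt_div_iff₀ (by positivity)] at h1
  nlinarith [norm_nonneg (U t - V i t)]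

/-- The Galerkin approximations converge, uniformly on `[0, T]`, to a solution of the nonlinear
system: by continuous dependence on the data they form a Cauchy family. -/
theorem exists_isSol [CompleteSpace H] (hμ : ∀ k, 0 < μ k) (hB : IsDiag e (fun k => (μ k)⁻¹) B)
    (β : ℝ) (f g : H) {T : ℝ} (hT : 0 ≤ T) (u₀ : H × H × H) :
    ∃ U : ℝ → H × H × H, IsSol e μ B β f g T U ∧ U 0 = u₀ ∧
      ∀ t, U t = U (projIcc 0 T hT t) := by
  obtain ⟨P, hP⟩ := exists_projection e
  obtain ⟨R, hR⟩ := exists_galerkin hμ hB β f g hP hT u₀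
  choose V hV hV0 hVproj hVR using hR
  have hPt := fun x => tendsto_projection hP x
  set L := nonlinLip B β R with hL
  have hL0 : 0 ≤ L := nonlinLip_nonneg B β R
  set δ : Finset ι × Finset ι → ℝ := fun p => (energy (V p.1 0 - V p.2 0)
    + (‖P p.1 f - P p.2 f‖ ^ 2 + ‖P p.1 g - P p.2 g‖ ^ 2) * T) * Real.exp ((L + 1) * T) with hδ
  have hV0t : Tendsto (fun F => V F 0) atTop (𝓝 u₀) := by
    simp only [hV0]
    exact (hPt _).prodMk_nhds ((hPt _).prodMk_nhds (hPt _))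
  have hδt : Tendsto δ (atTop ×ˢ atTop) (𝓝 0) := by
    have hdiff : ∀ {X : Type _} [NormedAddCommGroup X] {W : Finset ι → X} {w : X},
        Tendsto W atTop (𝓝 w) →
        Tendsto (fun p : Finset ι × Finset ι => W p.1 - W p.2) (atTop ×ˢ atTop) (𝓝 0) := by
      intro X _ W w hW
      have := (hW.comp (tendsto_fst (g := (atTop : Filter (Finset ι))))).sub
        (hW.comp (tendsto_snd (f := (atTop : Filter (Finset ι)))))
      rwa [sub_self] at this
    have h1 := (continuous_energy.tendsto _).comp (hdiff hV0t)
    have h2 := (hdiff (hPt f)).norm.pow 2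
    have h3 := (hdiff (hPt g)).norm.pow 2
    have h4 := (h1.add ((h2.add h3).mul_const T)).mul_const (Real.exp ((L + 1) * T))
    have h0 : (energy (0 : H × H × H) + (‖(0 : H)‖ ^ 2 + ‖(0 : H)‖ ^ 2) * T)
        * Real.exp ((L + 1) * T) = 0 := by simp [energy]
    rw [h0] at h4
    exact h4
  have hbound : ∀ F G t, ‖V F t - V G t‖ ^ 2 ≤ δ (F, G) := by
    intro F G t
    rw [hVproj F t, hVproj G t]
    have hs := (projIcc 0 T hT t).2
    refine (norm_sq_le_energy _).trans (((hV F).energy_sub_le (hV G) (fun k => (hμ k).le)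
      (fun t _ => hVR F t) (fun t _ => hVR G t) hs).trans ?_)
    have h0 := energy_nonneg (V F 0 - V G 0)
    simp only [hδ]
    gcongr
    · exact hs.2
    · exact hs.2
  have hcauchy : UniformCauchySeqOn V atTop univ := by
    intro u hu
    obtain ⟨ε, hε, hεu⟩ := Metric.mem_uniformity_dist.1 hu
    filter_upwards [hδt.eventually (gt_mem_nhds (pow_pos hε 2))] with p hp t _
    apply hεu
    rw [dist_eq_norm]
    exact lt_of_pow_lt_pow_left₀ 2 hε.le ((hbound p.1 p.2 t).trans_lt hp)
  have hlim : ∀ t, ∃ w, Tendsto (fun F => V F t) atTop (𝓝 w) := fun t =>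
    cauchy_map_iff_exists_tendsto.1 (hcauchy.cauchy_map (mem_univ t))
  choose U hU using hlim
  have hunif : TendstoUniformly V U atTop := by
    rw [← tendstoUniformlyOn_univ]
    exact hcauchy.tendstoUniformlyOn_of_tendsto fun t _ => hU t
  have hUc : Continuous U := hunif.continuous (Frequently.of_forall fun F => (hV F).cont)
  have hUR : ∀ t, ‖U t‖ ≤ R := fun t =>
    le_of_tendsto (hU t).norm (Eventually.of_forall fun F => hVR F t)
  have hinner : ∀ k x, |inner ℝ (e k) x| ≤ ‖x‖ := fun k x => by
    have := abs_real_inner_le_norm (e k) x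
    rwa [e.orthonormal.1 k, one_mul] at this
  have hn1 : ∀ F t, ‖(U t).1 - (V F t).1‖ ≤ ‖U t - V F t‖ := fun F t => norm_fst_le (U t - V F t)
  have hn2 : ∀ F t, ‖(U t).2.1 - (V F t).2.1‖ ≤ ‖U t - V F t‖ := fun F t =>
    (norm_fst_le (U t - V F t).2).trans (norm_snd_le _)
  have hn3 : ∀ F t, ‖(U t).2.2 - (V F t).2.2‖ ≤ ‖U t - V F t‖ := fun F t =>
    (norm_snd_le (U t - V F t).2).trans (norm_snd_le _)
  have hPt0 : ∀ x, Tendsto (fun F => ‖x - P F x‖) atTop (𝓝 0) := fun x => by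
    have := ((hPt x).const_sub x).norm
    simpa using this
  refine ⟨U, ⟨hUc, fun k t ht => ?_, fun k t ht => ?_, fun k t ht => ?_⟩,
    tendsto_nhds_unique (hU 0) hV0t, fun t => ?_⟩
  · refine hasDerivAt_of_tendstoUniformlyOn (l := atTop) isOpen_Ioo
      (f := fun F s => inner ℝ (e k) (V F s).1)
      (f' := fun F s => μ k * inner ℝ (e k) (V F s).2.1)
      (g' := fun s => μ k * inner ℝ (e k) (U s).2.1) ?_
      (Eventually.of_forall fun F s hs => (hV F).deriv_x k s hs)
      (fun s _ => tendsto_const_nhds.inner (hU s).fst_nhds) ht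
    refine tendstoUniformlyOn_of_dist_le hunif (tendsto_const_nhds (x := (0 : ℝ))) (hμ k).le
      fun F s _ => ?_
    rw [← mul_sub, ← inner_sub_right, abs_mul, abs_of_pos (hμ k), add_zero]
    exact mul_le_mul_of_nonneg_left ((hinner k _).trans (hn2 F s)) (hμ k).le
  · refine hasDerivAt_of_tendstoUniformlyOn (l := atTop) isOpen_Ioo
      (f := fun F s => inner ℝ (e k) (V F s).2.1)
      (f' := fun F s => μ k * (inner ℝ (e k) (V F s).2.2 - inner ℝ (e k) (V F s).1)
        + inner ℝ (e k) (P F f - nonlin B β (V F s).1))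
      (g' := fun s => μ k * (inner ℝ (e k) (U s).2.2 - inner ℝ (e k) (U s).1)
        + inner ℝ (e k) (f - nonlin B β (U s).1)) ?_
      (Eventually.of_forall fun F s hs => (hV F).deriv_v k s hs)
      (fun s _ => tendsto_const_nhds.inner (hU s).snd_nhds.fst_nhds) ht
    refine tendstoUniformlyOn_of_dist_le hunif (hPt0 f) (C := 2 * μ k + L)
      (by linarith [hμ k]) fun F s _ => ?_
    have hN := norm_nonlin_sub_le B β ((norm_fst_le _).trans (hUR s))
      ((norm_fst_le _).trans (hVR F s))
    have hdec : μ k * (inner ℝ (e k) (U s).2.2 - inner ℝ (e k) (U s).1)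
        + inner ℝ (e k) (f - nonlin B β (U s).1)
        - (μ k * (inner ℝ (e k) (V F s).2.2 - inner ℝ (e k) (V F s).1)
        + inner ℝ (e k) (P F f - nonlin B β (V F s).1))
        = μ k * inner ℝ (e k) ((U s).2.2 - (V F s).2.2)
          - μ k * inner ℝ (e k) ((U s).1 - (V F s).1)
          + inner ℝ (e k) (f - P F f)
          - inner ℝ (e k) (nonlin B β (U s).1 - nonlin B β (V F s).1) := by
      simp only [inner_sub_right]; ring
    rw [hdec]
    refine (abs_sub _ _).trans ?_
    have a1 := (hinner k ((U s).2.2 - (V F s).2.2)).trans (hn3 F s)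
    have a2 := (hinner k ((U s).1 - (V F s).1)).trans (hn1 F s)
    have a3 := hinner k (f - P F f)
    have a4 := (hinner k (nonlin B β (U s).1 - nonlin B β (V F s).1)).trans
      (hN.trans (mul_le_mul_of_nonneg_left (hn1 F s) hL0))
    have b1 := mul_le_mul_of_nonneg_left a1 (hμ k).le
    have b2 := mul_le_mul_of_nonneg_left a2 (hμ k).le
    have c1 := abs_add_le (μ k * inner ℝ (e k) ((U s).2.2 - (V F s).2.2)
      - μ k * inner ℝ (e k) ((U s).1 - (V F s).1)) (inner ℝ (e k) (f - P F f))
    have c2 := abs_sub (μ k * inner ℝ (e k) ((U s).2.2 - (V F s).2.2))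
      (μ k * inner ℝ (e k) ((U s).1 - (V F s).1))
    rw [abs_mul, abs_mul, abs_of_pos (hμ k)] at c2
    linarith
  · refine hasDerivAt_of_tendstoUniformlyOn (l := atTop) isOpen_Ioo
      (f := fun F s => inner ℝ (e k) (V F s).2.2)
      (f' := fun F s => -(μ k * (inner ℝ (e k) (V F s).2.2 + inner ℝ (e k) (V F s).2.1))
        + inner ℝ (e k) (P F g))
      (g' := fun s => -(μ k * (inner ℝ (e k) (U s).2.2 + inner ℝ (e k) (U s).2.1))
        + inner ℝ (e k) g) ?_
      (Eventually.of_forall fun F s hs => (hV F).deriv_θ k s hs)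
      (fun s _ => tendsto_const_nhds.inner (hU s).snd_nhds.snd_nhds) ht
    refine tendstoUniformlyOn_of_dist_le hunif (hPt0 g) (C := 2 * μ k)
      (by linarith [hμ k]) fun F s _ => ?_
    have hdec : -(μ k * (inner ℝ (e k) (U s).2.2 + inner ℝ (e k) (U s).2.1)) + inner ℝ (e k) g
        - (-(μ k * (inner ℝ (e k) (V F s).2.2 + inner ℝ (e k) (V F s).2.1))
          + inner ℝ (e k) (P F g))
        = inner ℝ (e k) (g - P F g) - (μ k * inner ℝ (e k) ((U s).2.2 - (V F s).2.2)
          + μ k * inner ℝ (e k) ((U s).2.1 - (V F s).2.1)) := by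
      simp only [inner_sub_right]; ring
    rw [hdec]
    refine (abs_sub _ _).trans ?_
    have a1 := (hinner k ((U s).2.2 - (V F s).2.2)).trans (hn3 F s)
    have a2 := (hinner k ((U s).2.1 - (V F s).2.1)).trans (hn2 F s)
    have a3 := hinner k (g - P F g)
    have b1 := mul_le_mul_of_nonneg_left a1 (hμ k).le
    have b2 := mul_le_mul_of_nonneg_left a2 (hμ k).le
    have c2 := abs_add_le (μ k * inner ℝ (e k) ((U s).2.2 - (V F s).2.2))
      (μ k * inner ℝ (e k) ((U s).2.1 - (V F s).2.1))
    rw [abs_mul, abs_mul, abs_of_pos (hμ k)] at c2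
    linarith
  · refine tendsto_nhds_unique (hU t) ?_
    have h := hU (projIcc 0 T hT t)
    simp only [← hVproj] at h
    exact h

/-- There is a global solution for every initial datum: the solutions on `[0, N + 1]` are glued by
uniqueness. -/
theorem exists_isSol_global [CompleteSpace H] (hμ : ∀ k, 0 < μ k)
    (hB : IsDiag e (fun k => (μ k)⁻¹) B) (β : ℝ) (f g : H) (u₀ : H × H × H) :
    ∃ U : ℝ → H × H × H, U 0 = u₀ ∧ ∀ T, IsSol e μ B β f g T U := by
  have hN0 : ∀ N : ℕ, (0 : ℝ) ≤ N + 1 := fun N => by positivity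
  choose V hV hV0 hVproj using fun N : ℕ => exists_isSol hμ hB β f g (hN0 N) u₀
  set U : ℝ → H × H × H := fun t => V ⌊t⌋₊ t with hU
  have heq : ∀ N : ℕ, ∀ t < (N : ℝ) + 1, U t = V N t := by
    intro N t ht
    rcases le_total t 0 with h0 | h0
    · simp only [hU]
      rw [hVproj ⌊t⌋₊ t, hVproj N t, projIcc_of_le_left _ h0, projIcc_of_le_left _ h0, hV0, hV0]
    · have hle : ⌊t⌋₊ ≤ N := by
        rw [← Nat.lt_add_one_iff, Nat.floor_lt h0]
        exact_mod_cast ht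
      have hle' : (⌊t⌋₊ : ℝ) + 1 ≤ (N : ℝ) + 1 := by
        have : (⌊t⌋₊ : ℝ) ≤ N := by exact_mod_cast hle
        linarith
      exact (hV ⌊t⌋₊).eq_of_eq_zero ((hV N).mono hle') (fun k => (hμ k).le)
        ((hV0 _).trans (hV0 _).symm) ⟨h0, (Nat.lt_floor_add_one t).le⟩
  have hev : ∀ N : ℕ, ∀ t < (N : ℝ) + 1, U =ᶠ[𝓝 t] V N := fun N t ht => by
    filter_upwards [Iio_mem_nhds ht] with s hs using heq N s hs
  refine ⟨U, ?_, fun T => ?_⟩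
  · rw [heq 0 0 (by simp), hV0]
  · have hN : ∀ t : ℝ, t < (⌊t⌋₊ : ℝ) + 1 := fun t => Nat.lt_floor_add_one t
    refine ⟨?_, fun k t ht => ?_, fun k t ht => ?_, fun k t ht => ?_⟩
    · rw [continuous_iff_continuousAt]
      intro t
      exact (hV ⌊t⌋₊).cont.continuousAt.congr (hev _ t (hN t)).symm
    · have h := (hV ⌊t⌋₊).deriv_x k t ⟨ht.1, hN t⟩
      refine h.congr_of_eventuallyEq ?_
      filter_upwards [hev _ t (hN t)] with s hs
      rw [hs]
    · have h := (hV ⌊t⌋₊).deriv_v k t ⟨ht.1, hN t⟩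
      refine h.congr_of_eventuallyEq ?_
      filter_upwards [hev _ t (hN t)] with s hs
      rw [hs]
    · have h := (hV ⌊t⌋₊).deriv_θ k t ⟨ht.1, hN t⟩
      refine h.congr_of_eventuallyEq ?_
      filter_upwards [hev _ t (hN t)] with s hs
      rw [hs]

end Existence

/-! ### Fractional powers and the scale of spaces in terms of the eigenbasis -/

section Scales

universe u

variable {H : Type u} [NormedAddCommGroup H] [InnerProductSpace ℝ H] [CompleteSpace H]
  {A : H →ₗ.[ℝ] H} {ι : Type*} {e : HilbertBasis ι ℝ H} {lam : ι → ℝ}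

/-- The definition of `fracPowGraph`, which refers to all eigenvectors, amounts to a condition on
the coefficients in an eigenbasis. -/
theorem mem_fracPowGraph_iff (hA : IsSelfAdjoint A)
    (he : ∀ k, ∃ u : A.domain, (u : H) = e k ∧ A u = lam k • e k) {s : ℝ} {p : H × H} :
    p ∈ fracPowGraph A s ↔ ∀ k, inner ℝ (e k) p.2 = lam k ^ s * inner ℝ (e k) p.1 := by
  constructor
  · intro h k
    obtain ⟨u, hu1, hu2⟩ := he k
    have := h (lam k) u (by rw [hu1, hu2])
    rwa [hu1, real_inner_comm, real_inner_comm (e k) p.1] at this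
  · intro h ν w hw
    have hk : ∀ k, lam k = ν ∨ inner ℝ (e k) (w : H) = 0 := by
      intro k
      obtain ⟨u, hu1, hu2⟩ := he k
      have := inner_apply_comm hA u w
      rw [hu1, hu2, hw, real_inner_smul_left, real_inner_smul_right] at this
      rcases eq_or_ne (inner ℝ (e k) (w : H)) 0 with h0 | h0
      · exact Or.inr h0
      · exact Or.inl (mul_right_cancel₀ h0 this)
    have h1 := e.hasSum_inner_mul_inner p.2 (w : H)
    have h2 := (e.hasSum_inner_mul_inner p.1 (w : H)).mul_left (ν ^ s)
    have hf : (fun k => inner ℝ p.2 (e k) * inner ℝ (e k) (w : H))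
        = fun k => ν ^ s * (inner ℝ p.1 (e k) * inner ℝ (e k) (w : H)) := by
      funext k
      rcases hk k with h0 | h0
      · rw [real_inner_comm, h k, h0, real_inner_comm (e k) p.1, mul_assoc]
      · rw [h0, mul_zero, mul_zero, mul_zero]
    rw [hf] at h1
    exact h1.unique h2

theorem fracPowGraph_functional (hA : IsSelfAdjoint A)
    (he : ∀ k, ∃ u : A.domain, (u : H) = e k ∧ A u = lam k • e k) (s : ℝ) :
    ∀ p ∈ fracPowGraph A s, p.1 = 0 → p.2 = 0 := by
  intro p hp h0
  rw [mem_fracPowGraph_iff hA he] at hp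
  refine ext_coef e fun k => ?_
  rw [hp k, h0, inner_zero_right, mul_zero]

theorem fracPow_coef (hA : IsSelfAdjoint A)
    (he : ∀ k, ∃ u : A.domain, (u : H) = e k ∧ A u = lam k • e k) {s : ℝ}
    (x : (fracPow A s).domain) (k : ι) :
    inner ℝ (e k) (fracPow A s x) = lam k ^ s * inner ℝ (e k) (x : H) :=
  (mem_fracPowGraph_iff hA he).1
    (Submodule.mem_graph_toLinearPMap (fracPowGraph_functional hA he s) x) k

theorem exists_mem_domain_fracPow (hA : IsSelfAdjoint A)
    (he : ∀ k, ∃ u : A.domain, (u : H) = e k ∧ A u = lam k • e k) {s : ℝ} {x y : H}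
    (h : ∀ k, inner ℝ (e k) y = lam k ^ s * inner ℝ (e k) x) :
    ∃ u : (fracPow A s).domain, (u : H) = x ∧ fracPow A s u = y := by
  have hmem : (x, y) ∈ (fracPow A s).graph := by
    rw [fracPow, Submodule.toLinearPMap_graph_eq _ (fracPowGraph_functional hA he s)]
    exact (mem_fracPowGraph_iff hA he).2 h
  exact (LinearPMap.mem_graph_iff _).1 hmem

/-- What the evolution problem needs to know about `A`: a Hilbert basis `e` of eigenvectors of
`A ^ (1/2)` with eigenvalues `μ`, and `B = A ^ (-1/2)`, which identifies `H` with `H²`. -/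
structure SpectralData (A : H →ₗ.[ℝ] H) (e : HilbertBasis ι ℝ H) (μ : ι → ℝ) (B : H →L[ℝ] H) :
    Prop where
  pos : ∀ k, 0 < μ k
  isDiag : IsDiag e (fun k => (μ k)⁻¹) B
  incl_eq : ∀ φ : Scale A 2, Scale.incl φ = B (Scale.op φ)
  op_bijective : Function.Bijective (Scale.op : Scale A 2 → H)
  scaleNorm_sq : ∀ φ : Scale A 2,
    scaleNorm A 1 (Scale.incl φ) ^ 2 = inner ℝ (B (Scale.op φ)) (Scale.op φ)

theorem exists_spectralData (hA : IsSelfAdjoint A) (hpos : StrictlyPositive A)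
    (hcpt : CompactlyEmbeddedDomain A) :
    ∃ (ι : Type u) (e : HilbertBasis ι ℝ H) (μ : ι → ℝ) (B : H →L[ℝ] H),
      SpectralData A e μ B := by
  obtain ⟨ι, e, lam, c, hc0, hc, he⟩ := exists_eigenbasis hA hpos hcpt
  have hlam : ∀ k, 0 < lam k := fun k => hc0.trans_le (hc k)
  set μ : ι → ℝ := fun k => lam k ^ ((2 : ℝ) / 4) with hμ
  have hμ0 : ∀ k, 0 < μ k := fun k => Real.rpow_pos_of_pos (hlam k) _
  have hbd : ∀ s : ℝ, 0 ≤ s → ∀ k, |(lam k ^ s)⁻¹| ≤ (c ^ s)⁻¹ := fun s hs k => by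
    rw [abs_of_pos (inv_pos.2 (Real.rpow_pos_of_pos (hlam k) _))]
    exact inv_anti₀ (Real.rpow_pos_of_pos hc0 _) (Real.rpow_le_rpow hc0.le (hc k) hs)
  obtain ⟨B, hB⟩ := exists_isDiag e (fun k => (μ k)⁻¹) _ (hbd (2 / 4) (by norm_num))
  -- `Q = A ^ (-1/4)`, a square root of `B`
  obtain ⟨Q, hQ⟩ := exists_isDiag e (fun k => (lam k ^ ((1 : ℝ) / 4))⁻¹) _
    (hbd (1 / 4) (by norm_num))
  have hBk : ∀ k x, inner ℝ (e k) (B x) = (μ k)⁻¹ * inner ℝ (e k) x := hB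
  have hQk : ∀ k x, inner ℝ (e k) (Q x) = (lam k ^ ((1 : ℝ) / 4))⁻¹ * inner ℝ (e k) x := hQ
  have hsplit : ∀ k, μ k = lam k ^ ((1 : ℝ) / 4) * lam k ^ ((1 : ℝ) / 4) := fun k => by
    rw [← Real.rpow_add (hlam k)]; norm_num [hμ]
  have hQQ : ∀ x, Q (Q x) = B x := fun x => ext_coef e fun k => by
    rw [hQk, hQk, hBk, hsplit, mul_inv, mul_assoc]
  have hopk : ∀ (φ : Scale A 2) k, inner ℝ (e k) (Scale.op φ)
      = μ k * inner ℝ (e k) (Scale.incl φ) := fun φ k => fracPow_coef hA he φ k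
  have hincl : ∀ φ : Scale A 2, Scale.incl φ = B (Scale.op φ) := fun φ => ext_coef e fun k => by
    rw [hBk, hopk, inv_mul_cancel_left₀ (hμ0 k).ne']
  refine ⟨ι, e, μ, B, hμ0, hB, hincl, ⟨fun φ ψ h => ?_, fun x => ?_⟩, fun φ => ?_⟩
  · have : (Scale.incl φ : H) = Scale.incl ψ := by rw [hincl, hincl, h]
    exact Subtype.ext this
  · obtain ⟨w, -, hw⟩ := exists_mem_domain_fracPow hA he (s := 2 / 4) (x := B x)
      (y := x) fun k => by
      rw [hBk]
      exact (mul_inv_cancel_left₀ (hμ0 k).ne' _).symm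
    exact ⟨w, hw⟩
  · obtain ⟨w, hw1, hw2⟩ := exists_mem_domain_fracPow hA he (s := 1 / 4) (x := Scale.incl φ)
      (y := Q (Scale.op φ)) fun k => by
        rw [hQk, hincl, hBk, hsplit, mul_inv, ← mul_assoc, ← mul_assoc,
          mul_inv_cancel₀ (Real.rpow_pos_of_pos (hlam k) _).ne', one_mul]
    have hdom : Scale.incl φ ∈ (fracPow A (1 / 4)).domain := hw1 ▸ w.2
    have hww : w = ⟨Scale.incl φ, hdom⟩ := Subtype.ext hw1
    rw [scaleNorm, dif_pos hdom, ← hww, hw2, ← real_inner_self_eq_norm_sq, ← hQQ,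
      hQ.inner_comm (Q (Scale.op φ))]

end Scales

/-! ### Weak solutions and the system of modes -/

section Weak

variable {H : Type*} [NormedAddCommGroup H] [InnerProductSpace ℝ H]
  {A : H →ₗ.[ℝ] H} {ι : Type*} {e : HilbertBasis ι ℝ H} {μ : ι → ℝ} {B : H →L[ℝ] H}

/-- The isometry `(u, v, θ) ↦ (A ^ (1/2) u, v, θ)` of the phase space with `H × H × H`. -/
def toState (z : Phase A) : H × H × H := (Scale.op z.1, z.2)

theorem isometry_toState : Isometry (toState : Phase A → H × H × H) := by
  refine Isometry.of_dist_eq fun z w => ?_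
  have h : dist z.1 w.1 = dist (Scale.op z.1) (Scale.op w.1) := rfl
  have h1 : dist z w = max (dist z.1 w.1) (dist z.2 w.2) := Prod.dist_eq
  rw [Prod.dist_eq, h1, h]
  rfl

theorem exists_bound_toState {K : Set (Phase A)} (hK : IsCompact K) :
    ∃ R, ∀ z ∈ K, ‖toState z‖ ≤ R :=
  hK.exists_bound_of_continuousOn isometry_toState.continuous.continuousOn

/-- A continuous curve whose coefficients have the derivatives given by a continuous curve is
differentiable, up to the endpoint `0`. -/
theorem hasDerivWithinAt_of_coef [CompleteSpace H] {W w : ℝ → H} (hW : Continuous W)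
    (hw : Continuous w)
    (h : ∀ k, ∀ t, 0 < t → HasDerivAt (fun s => inner ℝ (e k) (W s)) (inner ℝ (e k) (w t)) t)
    {t : ℝ} (ht : 0 ≤ t) : HasDerivWithinAt W (w t) (Ici 0) t := by
  have heq : ∀ s ∈ Ici (0 : ℝ), W s = W 0 + ∫ τ in (0 : ℝ)..s, w τ := by
    intro s hs
    refine ext_coef e fun k => ?_
    have h1 := intervalIntegral.integral_eq_sub_of_hasDerivAt_of_le hs
      (f := fun s => inner ℝ (e k) (W s)) (f' := fun s => inner ℝ (e k) (w s))
      (Continuous.continuousOn (by fun_prop)) (fun τ hτ => h k τ hτ.1)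
      (Continuous.intervalIntegrable (by fun_prop) _ _)
    have hwi : IntervalIntegrable w MeasureTheory.volume 0 s := hw.intervalIntegrable _ _
    have h2 := (innerSL ℝ (e k)).intervalIntegral_comp_comm hwi
    simp only [innerSL_apply_apply] at h2
    rw [inner_add_right, ← h2, h1]
    ring
  have hd : HasDerivAt (fun s => W 0 + ∫ τ in (0 : ℝ)..s, w τ) (w t) t :=
    ((hw.integral_hasStrictDerivAt 0 t).hasDerivAt).const_add _
  exact hd.hasDerivWithinAt.congr heq (heq t ht)

namespace SpectralData

theorem bijective_toState (D : SpectralData A e μ B) :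
    Function.Bijective (toState : Phase A → H × H × H) := by
  constructor
  · rintro ⟨x, y⟩ ⟨x', y'⟩ h
    simp only [toState, Prod.mk.injEq] at h
    exact Prod.ext (D.op_bijective.1 h.1) h.2
  · rintro ⟨x, y⟩
    obtain ⟨φ, hφ⟩ := D.op_bijective.2 x
    exact ⟨(φ, y), by simp [toState, hφ]⟩

/-- The equations of the modes are the weak equations tested with eigenvectors. The curve is
extended to negative times by its initial value. -/
theorem isSol_of_isWeakSolution (D : SpectralData A e μ B) {β : ℝ} {f g : H} {z : ℝ → Phase A}
    (hz : IsWeakSolution A β f g z) (T : ℝ) :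
    IsSol e μ B β f g T (fun t => toState (z (max t 0))) := by
  have hmax : ∀ t : ℝ, 0 < t → ∀ᶠ s in 𝓝 t, max s 0 = s := fun t ht => by
    filter_upwards [Ioi_mem_nhds ht] with s hs using max_eq_left (le_of_lt hs)
  have hBk : ∀ k x, inner ℝ (e k) (B x) = (μ k)⁻¹ * inner ℝ (e k) x := D.isDiag
  have hB : ∀ k (φ : Scale A 2), Scale.op φ = μ k • e k → Scale.incl φ = e k := by
    intro k φ hφ
    rw [D.incl_eq, hφ, map_smul, D.isDiag.apply_basis, smul_inv_smul₀ (D.pos k).ne']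
  refine ⟨?_, fun k t ht => ?_, fun k t ht => ?_, fun k t ht => ?_⟩
  · exact isometry_toState.continuous.comp
      (hz.continuousOn.comp_continuous (by fun_prop) fun t => le_max_right t 0)
  · have h := ((hz.deriv_u t ht.1.le).hasDerivAt (Ici_mem_nhds ht.1))
    have h1 := ((innerSL ℝ (e k)).hasFDerivAt.comp_hasDerivAt t h).const_mul (μ k)
    simp only [max_eq_left ht.1.le]
    refine h1.congr_of_eventuallyEq ?_
    filter_upwards [hmax t ht.1] with s hs
    simp only [hs, Function.comp_apply, innerSL_apply_apply, toState]
    rw [D.incl_eq, hBk, mul_inv_cancel_left₀ (D.pos k).ne']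
  · obtain ⟨φ, hφ⟩ := D.op_bijective.2 (μ k • e k)
    have h := (hz.eq_u φ t ht.1.le).hasDerivAt (Ici_mem_nhds ht.1)
    rw [hB k φ hφ, hφ, D.scaleNorm_sq] at h
    simp only [max_eq_left ht.1.le]
    refine (h.congr_of_eventuallyEq ?_).congr_deriv ?_
    · filter_upwards [hmax t ht.1] with s hs
      simp only [hs, toState]
      rw [real_inner_comm]
    · simp only [toState, nonlin, inner_sub_right, real_inner_smul_right]
      rw [real_inner_comm (e k) f, real_inner_comm (e k) (Scale.op (z t).1),
        real_inner_comm (e k) (z t).2.2]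
      ring
  · obtain ⟨φ, hφ⟩ := D.op_bijective.2 (μ k • e k)
    have h := (hz.eq_θ φ t ht.1.le).hasDerivAt (Ici_mem_nhds ht.1)
    rw [hB k φ hφ, hφ] at h
    simp only [max_eq_left ht.1.le]
    refine (h.congr_of_eventuallyEq ?_).congr_deriv ?_
    · filter_upwards [hmax t ht.1] with s hs
      simp only [hs, toState]
      rw [real_inner_comm]
    · simp only [toState, real_inner_smul_right]
      rw [real_inner_comm (e k) g, real_inner_comm (e k) (z t).2.1,
        real_inner_comm (e k) (z t).2.2]
      ring

/-- The equations of the modes determine the strong derivatives of `B x`, `B v` and `B θ`. A test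
function in `H²` has the form `B ψ`, so the weak equations follow by taking inner products with
`ψ`. -/
theorem isWeakSolution_of_isSol [CompleteSpace H] (D : SpectralData A e μ B) {β : ℝ}
    {f g : H} {z : ℝ → Phase A}
    (hz : ∀ T, IsSol e μ B β f g T (fun t => toState (z t))) : IsWeakSolution A β f g z := by
  have hc : Continuous fun t => toState (z t) := (hz 0).cont
  have hx : Continuous fun t => Scale.op (z t).1 := hc.fst
  have hv : Continuous fun t => (z t).2.1 := hc.snd.fst
  have hθ : Continuous fun t => (z t).2.2 := hc.snd.snd
  have hN : Continuous fun t => nonlin B β (Scale.op (z t).1) := (continuous_nonlin B β).comp hx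
  have hBk : ∀ k x, inner ℝ (e k) (B x) = (μ k)⁻¹ * inner ℝ (e k) x := D.isDiag
  have hT : ∀ t : ℝ, 0 < t → t ∈ Ioo 0 (t + 1) := fun t ht => ⟨ht, lt_add_one t⟩
  have hdu : ∀ t, 0 ≤ t → HasDerivWithinAt (fun s => B (Scale.op (z s).1)) (z t).2.1 (Ici 0) t := by
    intro t ht
    refine hasDerivWithinAt_of_coef (e := e) (w := fun t => (z t).2.1) (B.continuous.comp hx) hv
      (fun k t ht => ?_) ht
    have h := ((hz (t + 1)).deriv_x k t (hT t ht)).const_mul (μ k)⁻¹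
    exact (h.congr_of_eventuallyEq (Eventually.of_forall fun s => hBk k _)).congr_deriv
      (inv_mul_cancel_left₀ (D.pos k).ne' _)
  have hdv : ∀ t, 0 ≤ t → HasDerivWithinAt (fun s => B (z s).2.1)
      ((z t).2.2 - Scale.op (z t).1 + B (f - nonlin B β (Scale.op (z t).1))) (Ici 0) t := by
    intro t ht
    refine hasDerivWithinAt_of_coef (e := e)
      (w := fun t => (z t).2.2 - Scale.op (z t).1 + B (f - nonlin B β (Scale.op (z t).1)))
      (B.continuous.comp hv) (by fun_prop) (fun k t ht => ?_) ht
    have h := ((hz (t + 1)).deriv_v k t (hT t ht)).const_mul (μ k)⁻¹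
    refine (h.congr_of_eventuallyEq (Eventually.of_forall fun s => hBk k _)).congr_deriv ?_
    rw [mul_add, inv_mul_cancel_left₀ (D.pos k).ne', inner_add_right, hBk]
    simp only [inner_sub_right]
    rfl
  have hdθ : ∀ t, 0 ≤ t → HasDerivWithinAt (fun s => B (z s).2.2)
      (B g - ((z t).2.2 + (z t).2.1)) (Ici 0) t := by
    intro t ht
    refine hasDerivWithinAt_of_coef (e := e) (w := fun t => B g - ((z t).2.2 + (z t).2.1))
      (B.continuous.comp hθ) (by fun_prop) (fun k t ht => ?_) ht
    have h := ((hz (t + 1)).deriv_θ k t (hT t ht)).const_mul (μ k)⁻¹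
    refine (h.congr_of_eventuallyEq (Eventually.of_forall fun s => hBk k _)).congr_deriv ?_
    rw [mul_add, mul_neg, inv_mul_cancel_left₀ (D.pos k).ne', inner_sub_right, inner_add_right, hBk]
    simp only [toState]
    ring
  refine ⟨?_, fun t ht => ?_, fun φ t ht => ?_, fun φ t ht => ?_⟩
  · exact (isometry_toState.comp_continuous_iff.1 hc).continuousOn
  · simp only [D.incl_eq]
    exact hdu t ht
  · have h := (innerSL ℝ (Scale.op φ)).hasFDerivAt.comp_hasDerivWithinAt t (hdv t ht)
    refine (h.congr_deriv ?_).congr (fun s _ => ?_) ?_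
    · simp only [innerSL_apply_apply, inner_add_right, inner_sub_right, map_sub, nonlin, map_smul,
        real_inner_smul_right]
      rw [D.scaleNorm_sq, D.incl_eq φ, ← D.isDiag.inner_comm (Scale.op φ) f,
        ← D.isDiag.inner_comm (Scale.op φ), real_inner_comm (Scale.op φ) (z t).2.2,
        real_inner_comm (Scale.op φ) (Scale.op (z t).1), real_inner_comm (B (Scale.op φ)) f,
        real_inner_comm (B (Scale.op φ)) (Scale.op (z t).1)]
      ring
    · simp only [Function.comp_apply, innerSL_apply_apply]
      rw [D.incl_eq φ, ← D.isDiag.inner_comm, real_inner_comm]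
    · simp only [Function.comp_apply, innerSL_apply_apply]
      rw [D.incl_eq φ, ← D.isDiag.inner_comm, real_inner_comm]
  · have h := (innerSL ℝ (Scale.op φ)).hasFDerivAt.comp_hasDerivWithinAt t (hdθ t ht)
    refine (h.congr_deriv ?_).congr (fun s _ => ?_) ?_
    · simp only [innerSL_apply_apply, inner_add_right, inner_sub_right]
      rw [D.incl_eq φ, ← D.isDiag.inner_comm (Scale.op φ) g,
        real_inner_comm (Scale.op φ) (z t).2.2, real_inner_comm (Scale.op φ) (z t).2.1,
        real_inner_comm (B (Scale.op φ)) g]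
      ring
    · simp only [Function.comp_apply, innerSL_apply_apply]
      rw [D.incl_eq φ, ← D.isDiag.inner_comm, real_inner_comm]
    · simp only [Function.comp_apply, innerSL_apply_apply]
      rw [D.incl_eq φ, ← D.isDiag.inner_comm, real_inner_comm]

/-- The solution operators are given by the solutions of the system of modes: weak solutions
exist, so that the junk value in the definition of `solOp` is not used. -/
theorem exists_isSol_solOp [CompleteSpace H] (D : SpectralData A e μ B) (β : ℝ)
    (f g : H) (z₀ : Phase A) :
    ∃ U : ℝ → H × H × H, U 0 = toState z₀ ∧ (∀ T, IsSol e μ B β f g T U) ∧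
      ∀ t, 0 ≤ t → toState (solOp A β f g t z₀) = U t := by
  have hex : ∃ z : ℝ → Phase A, IsWeakSolution A β f g z ∧ z 0 = z₀ := by
    obtain ⟨U, hU0, hU⟩ := exists_isSol_global D.pos D.isDiag β f g (toState z₀)
    choose z hz using fun t => D.bijective_toState.2 (U t)
    refine ⟨z, D.isWeakSolution_of_isSol fun T => ?_, D.bijective_toState.1 ((hz 0).trans hU0)⟩
    simp only [hz]
    exact hU T
  have hspec := hex.choose_spec
  refine ⟨fun t => toState (hex.choose (max t 0)), ?_,
    D.isSol_of_isWeakSolution hspec.1, fun t ht => ?_⟩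
  · simp only [max_self]
    rw [hspec.2]
  · simp only [max_eq_left ht]
    rw [solOp, dif_pos hex]

end SpectralData

end Weak

/-! ### The extension of a semigroup of bijections to a flow -/

section FlowExtension

open Function

/-- A semigroup of bijections of a compact Hausdorff space, jointly continuous for nonnegative
times, extends to a flow: the inverses are continuous by compactness, and `Φ t` is
`S (t + r) ∘ (S r)⁻¹` for every sufficiently large `r`. -/
theorem exists_flow_of_bijective {X : Type*} [TopologicalSpace X] [CompactSpace X] [T2Space X]
    (S : ℝ → X → X) (h0 : ∀ x, S 0 x = x)
    (hadd : ∀ s t, 0 ≤ s → 0 ≤ t → ∀ x, S (s + t) x = S s (S t x))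
    (hbij : ∀ t, 0 ≤ t → Bijective (S t))
    (hcont : ∀ T, ContinuousOn (uncurry S) (Icc 0 T ×ˢ univ)) :
    ∃ Φ : Flow ℝ X, ∀ t, 0 ≤ t → ∀ x, Φ t x = S t x := by
  have hScont : ∀ t, 0 ≤ t → Continuous (S t) := fun t ht =>
    (hcont t).comp_continuous (f := fun x => (t, x)) (by fun_prop)
      fun x => ⟨⟨ht, le_rfl⟩, mem_univ x⟩
  have hinv : ∀ r : ℝ, ∃ I : X → X, 0 ≤ r → Continuous I ∧ ∀ x, S r (I x) = x := by
    intro r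
    by_cases hr : 0 ≤ r
    · let E := Equiv.ofBijective (S r) (hbij r hr)
      have hE : Continuous E := hScont r hr
      exact ⟨(hE.homeoOfEquivCompactToT2).symm, fun _ =>
        ⟨Homeomorph.continuous _, fun x => E.apply_symm_apply x⟩⟩
    · exact ⟨id, fun h => absurd h hr⟩
  choose I hI using hinv
  have hIc : ∀ r, 0 ≤ r → Continuous (I r) := fun r hr => (hI r hr).1
  have hSI : ∀ r, 0 ≤ r → ∀ x, S r (I r x) = x := fun r hr => (hI r hr).2
  let Φ : ℝ → X → X := fun t x => S (t + |t|) (I |t| x)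
  have hpos : ∀ t : ℝ, 0 ≤ t + |t| := fun t => by linarith [neg_abs_le t]
  -- the value does not depend on how far one goes back
  have hstep : ∀ t r d : ℝ, 0 ≤ r → 0 ≤ t + r → 0 ≤ d → ∀ x,
      S (t + (r + d)) (I (r + d) x) = S (t + r) (I r x) := by
    intro t r d hr htr hd x
    have h1 : S d (I (r + d) x) = I r x := by
      apply (hbij r hr).1
      rw [← hadd r d hr hd, hSI _ (by linarith), hSI r hr]
    rw [← add_assoc, hadd _ _ htr hd, h1]
  have hΦ : ∀ t r : ℝ, 0 ≤ r → 0 ≤ t + r → ∀ x, Φ t x = S (t + r) (I r x) := by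
    intro t r hr htr x
    have h1 := hstep t r |t| hr htr (abs_nonneg t) x
    have h2 := hstep t |t| r (abs_nonneg t) (hpos t) hr x
    rw [add_comm |t| r] at h2
    exact h2.symm.trans h1
  have hΦpos : ∀ t, 0 ≤ t → ∀ x, Φ t x = S t x := by
    intro t ht x
    rw [hΦ t 0 le_rfl (by linarith), add_zero]
    congr 1
    rw [← h0 (I 0 x), hSI 0 le_rfl]
  have hΦneg : ∀ r, 0 ≤ r → ∀ x, Φ (-r) x = I r x := by
    intro r hr x
    rw [hΦ (-r) r hr (by linarith), neg_add_cancel, h0]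
  refine ⟨⟨Φ, ?_, ?_, ?_⟩, hΦpos⟩
  · rw [continuous_iff_continuousAt]
    rintro ⟨t₀, x₀⟩
    set r := |t₀| + 1 with hr
    have hr0 : 0 ≤ r := by positivity
    have hnhds : ∀ᶠ p : ℝ × X in 𝓝 (t₀, x₀), p.1 ∈ Ioo (-r) r :=
      continuous_fst.continuousAt.eventually
        (Ioo_mem_nhds (by linarith [neg_abs_le t₀]) (by linarith [le_abs_self t₀]))
    have h1 : ContinuousOn (fun p : ℝ × X => uncurry S (p.1 + r, I r p.2))
        {p | p.1 ∈ Ioo (-r) r} := by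
      refine (hcont (2 * r)).comp (Continuous.continuousOn ?_) fun p hp => ?_
      · exact (continuous_fst.add continuous_const).prodMk ((hIc r hr0).comp continuous_snd)
      · exact ⟨⟨by linarith [hp.1], by linarith [hp.2]⟩, mem_univ _⟩
    refine (h1.continuousAt hnhds).congr ?_
    filter_upwards [hnhds] with p hp
    exact (hΦ p.1 r hr0 (by linarith [hp.1]) p.2).symm
  · intro s t x
    -- `x = S a y` for a time `a` that exceeds all the times involved
    set a := |s| + |t| with ha
    have ha0 : 0 ≤ a := by positivity
    have hs := neg_abs_le s
    have ht := neg_abs_le t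
    have hs' := abs_nonneg s
    have ht' := abs_nonneg t
    rw [hΦ (s + t) a ha0 (by linarith), hΦ t a ha0 (by linarith),
      hΦ s |s| hs' (by linarith)]
    set y := I a x
    have h1 : I |s| (S (t + a) y) = S (t + |t|) y := by
      apply (hbij |s| hs').1
      rw [hSI _ hs', ← hadd _ _ hs' (by linarith)]
      congr 1
      linarith
    rw [h1, ← hadd _ _ (by linarith) (by linarith)]
    congr 1
    linarith
  · intro x
    rw [hΦpos 0 le_rfl, h0]

end FlowExtension

/-! ### The solution operators on the attractor -/

section Attractor

variable {H : Type*} [NormedAddCommGroup H] [InnerProductSpace ℝ H] [CompleteSpace H]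
  {A : H →ₗ.[ℝ] H} {ι : Type*} {e : HilbertBasis ι ℝ H} {μ : ι → ℝ} {B : H →L[ℝ] H}
  {β : ℝ} {f g : H}

namespace SpectralData

theorem solOp_zero (D : SpectralData A e μ B) (z : Phase A) : solOp A β f g 0 z = z := by
  obtain ⟨U, hU0, -, hU⟩ := D.exists_isSol_solOp β f g z
  exact D.bijective_toState.1 ((hU 0 le_rfl).trans hU0)

theorem solOp_add (D : SpectralData A e μ B) {s t : ℝ} (hs : 0 ≤ s) (ht : 0 ≤ t) (z : Phase A) :
    solOp A β f g (s + t) z = solOp A β f g s (solOp A β f g t z) := by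
  obtain ⟨U, -, hUs, hU⟩ := D.exists_isSol_solOp β f g z
  obtain ⟨V, hV0, hVs, hV⟩ := D.exists_isSol_solOp β f g (solOp A β f g t z)
  apply D.bijective_toState.1
  rw [hU _ (add_nonneg hs ht), hV s hs]
  have hshift : IsSol e μ B β f g s (fun τ => U (τ + t)) := by
    have hmem : ∀ τ ∈ Ioo 0 s, τ + t ∈ Ioo 0 (s + t) := fun τ hτ =>
      ⟨by linarith [hτ.1], by linarith [hτ.2]⟩
    exact ⟨(hUs (s + t)).cont.comp (by fun_prop),
      fun k τ hτ => ((hUs (s + t)).deriv_x k _ (hmem τ hτ)).comp_add_const τ t,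
      fun k τ hτ => ((hUs (s + t)).deriv_v k _ (hmem τ hτ)).comp_add_const τ t,
      fun k τ hτ => ((hUs (s + t)).deriv_θ k _ (hmem τ hτ)).comp_add_const τ t⟩
  refine hshift.eq_of_eq_zero (hVs s) (fun k => (D.pos k).le) ?_ ⟨hs, le_rfl⟩
  rw [hV0, hU t ht, zero_add]

theorem solOp_injective [Countable ι] (D : SpectralData A e μ B) {t : ℝ} (ht : 0 < t)
    {z₁ z₂ : Phase A} (h : solOp A β f g t z₁ = solOp A β f g t z₂) : z₁ = z₂ := by
  obtain ⟨U, hU0, hUs, hU⟩ := D.exists_isSol_solOp β f g z₁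
  obtain ⟨V, hV0, hVs, hV⟩ := D.exists_isSol_solOp β f g z₂
  apply D.bijective_toState.1
  rw [← hU0, ← hV0]
  refine (hUs t).eq_zero_of_eq_end (hVs t) ht ?_
  rw [← hU t ht.le, ← hV t ht.le, h]

/-- On a set whose trajectories are bounded, continuous dependence is uniform in the initial value,
whence joint continuity. -/
theorem continuousOn_solOp (D : SpectralData A e μ B) {K : Set (Phase A)} {R : ℝ}
    (hK : ∀ t, 0 ≤ t → ∀ z ∈ K, ‖toState (solOp A β f g t z)‖ ≤ R) (T : ℝ) :
    ContinuousOn (fun p : ℝ × Phase A => solOp A β f g p.1 p.2) (Icc 0 T ×ˢ K) := by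
  set L := nonlinLip B β R with hL
  have hL0 : 0 ≤ L := nonlinLip_nonneg B β R
  set C := Real.sqrt (3 * Real.exp ((L + 1) * T)) with hC
  refine continuousOn_prod_of_continuousOn_lipschitzOnWith' _ (Real.toNNReal C)
    (fun t ht => LipschitzOnWith.of_dist_le_mul fun z hz w hw => ?_) fun z _ => ?_
  · obtain ⟨U, hU0, hUs, hU⟩ := D.exists_isSol_solOp β f g z
    obtain ⟨V, hV0, hVs, hV⟩ := D.exists_isSol_solOp β f g w
    rw [Real.coe_toNNReal _ (Real.sqrt_nonneg _), ← isometry_toState.dist_eq,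
      ← isometry_toState.dist_eq z w, hU t ht.1, hV t ht.1, ← hU0, ← hV0, dist_eq_norm,
      dist_eq_norm]
    have h := (hUs T).energy_sub_le (hVs T) (fun k => (D.pos k).le)
      (fun s hs => hU s hs.1 ▸ hK s hs.1 z hz) (fun s hs => hV s hs.1 ▸ hK s hs.1 w hw) ht
    have h1 : ‖U t - V t‖ ^ 2 ≤ (C * ‖U 0 - V 0‖) ^ 2 := by
      rw [mul_pow, hC, Real.sq_sqrt (by positivity)]
      calc ‖U t - V t‖ ^ 2 ≤ energy (U t - V t) := norm_sq_le_energy _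
        _ ≤ energy (U 0 - V 0) * Real.exp ((L + 1) * t) := by simpa using h
        _ ≤ (3 * ‖U 0 - V 0‖ ^ 2) * Real.exp ((L + 1) * T) := by
          have := energy_nonneg (U 0 - V 0)
          gcongr
          · exact energy_le_norm_sq _
          · exact ht.2
        _ = _ := by ring
    exact le_of_sq_le_sq h1 (by positivity)
  · obtain ⟨U, hU0, hUs, hU⟩ := D.exists_isSol_solOp β f g z
    rw [← isometry_toState.comp_continuousOn_iff]
    exact (hUs T).cont.continuousOn.congr fun t ht => hU t ht.1

end SpectralData

end Attractor

end ThermoBeam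

end

theorem proposition4p6 {H : Type*} [NormedAddCommGroup H] [InnerProductSpace ℝ H]
    [CompleteSpace H] [TopologicalSpace.SeparableSpace H]
    (A : H →ₗ.[ℝ] H) (hA_selfAdjoint : IsSelfAdjoint A)
    (hA_pos : ThermoBeam.StrictlyPositive A)
    (hA_compact : ThermoBeam.CompactlyEmbeddedDomain A)
    (β : ℝ) (f g : H) (𝔄 : Set (ThermoBeam.Phase A))
    (h𝔄 : ThermoBeam.IsGlobalAttractor (ThermoBeam.solOp A β f g) 𝔄) :
    (∀ t : ℝ, 0 < t → ∀ z₁ ∈ 𝔄, ∀ z₂ ∈ 𝔄,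
      ThermoBeam.solOp A β f g t z₁ = ThermoBeam.solOp A β f g t z₂ → z₁ = z₂) ∧
    (∀ t : ℝ, 0 ≤ t → Set.BijOn (ThermoBeam.solOp A β f g t) 𝔄 𝔄) ∧
    (∃ Φ : Flow ℝ 𝔄, ∀ t : ℝ, 0 ≤ t → ∀ z : 𝔄,
      (Φ t z : ThermoBeam.Phase A) = ThermoBeam.solOp A β f g t z) := by
  obtain ⟨ι, e, μ, B, D⟩ := ThermoBeam.exists_spectralData hA_selfAdjoint hA_pos hA_compact
  have hι : Countable ι := ThermoBeam.countable_of_hilbertBasis e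
  set S := ThermoBeam.solOp A β f g with hS
  have hinj : ∀ t : ℝ, 0 < t → ∀ z₁ ∈ 𝔄, ∀ z₂ ∈ 𝔄, S t z₁ = S t z₂ → z₁ = z₂ :=
    fun t ht z₁ _ z₂ _ h => D.solOp_injective ht h
  have hmaps : ∀ t : ℝ, 0 ≤ t → Set.MapsTo (S t) 𝔄 𝔄 := fun t ht z hz => by
    rw [← h𝔄.invariant t ht]
    exact Set.mem_image_of_mem _ hz
  have hbij : ∀ t : ℝ, 0 ≤ t → Set.BijOn (S t) 𝔄 𝔄 := by
    intro t ht
    refine ⟨hmaps t ht, ?_, (h𝔄.invariant t ht).ge⟩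
    rcases ht.eq_or_lt with h0 | h0
    · intro z₁ _ z₂ _ h
      rwa [← h0, hS, D.solOp_zero, D.solOp_zero] at h
    · exact fun z₁ hz₁ z₂ hz₂ h => hinj t h0 z₁ hz₁ z₂ hz₂ h
  refine ⟨hinj, hbij, ?_⟩
  have hcpt : CompactSpace 𝔄 := isCompact_iff_compactSpace.1 h𝔄.isCompact
  have hT2 : T2Space 𝔄 :=
    T2Space.of_injective_continuous (f := fun z : 𝔄 => ThermoBeam.toState (z : ThermoBeam.Phase A))
      (fun z w h => Subtype.ext (D.bijective_toState.1 h))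
      (ThermoBeam.isometry_toState.continuous.comp continuous_subtype_val)
  obtain ⟨R, hR⟩ := ThermoBeam.exists_bound_toState h𝔄.isCompact
  -- `max t 0` makes the restricted operators total in `t`
  let S' : ℝ → 𝔄 → 𝔄 := fun t z => ⟨S (max t 0) z, hmaps _ (le_max_right t 0) z.2⟩
  have hS' : ∀ t, 0 ≤ t → ∀ z, (S' t z : ThermoBeam.Phase A) = S t z := fun t ht z => by
    simp only [S', max_eq_left ht]
  obtain ⟨Φ, hΦ⟩ := ThermoBeam.exists_flow_of_bijective S'
    (fun z => Subtype.ext ((hS' 0 le_rfl z).trans (D.solOp_zero _)))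
    (fun s t hs ht z => Subtype.ext (by
      rw [hS' _ (add_nonneg hs ht), hS' s hs, hS' t ht]
      exact D.solOp_add hs ht _))
    (fun t ht => by
      constructor
      · intro z w h
        have h1 := congrArg (Subtype.val : 𝔄 → ThermoBeam.Phase A) h
        rw [hS' t ht, hS' t ht] at h1
        exact Subtype.ext ((hbij t ht).injOn z.2 w.2 h1)
      · intro w
        obtain ⟨z, hz, hzw⟩ := (hbij t ht).surjOn w.2
        exact ⟨⟨z, hz⟩, Subtype.ext ((hS' t ht _).trans hzw)⟩)
    (fun T => by
      rw [Topology.IsInducing.subtypeVal.continuousOn_iff]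
      have h1 := D.continuousOn_solOp (β := β) (f := f) (g := g) (K := 𝔄)
        (fun t ht z hz => hR _ (hmaps t ht hz)) T
      have h2 : ContinuousOn (fun p : ℝ × 𝔄 => S p.1 (p.2 : ThermoBeam.Phase A))
          (Set.Icc 0 T ×ˢ Set.univ) :=
        h1.comp (f := fun p : ℝ × 𝔄 => (p.1, (p.2 : ThermoBeam.Phase A)))
          (Continuous.continuousOn (by fun_prop)) fun p hp => ⟨hp.1, p.2.2⟩
      exact h2.congr fun p hp => hS' p.1 hp.1.1 p.2)
  exact ⟨Φ, fun t ht z => by rw [hΦ t ht z, hS' t ht]⟩
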